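/- Let $K$ be a non-archimedean local field with valuation ring $R$, maximal ideal $\mathfrak m$ and normalized discrete valuation $\mathrm{val}$ (so $\mathrm{val}(\pi)=1$ for a uniformizer $\pi$, and $\mathrm{val}(0)=\infty$), and let $S\subseteq R$ be an infinite subset, with closure $\overline S$. Definitions. A sequence $s_0,s_1,\dots$ of elements of $S$ is *factorial-determining* if for every $n\ge 0$ the element $s_n$ minimizes $\mathrm{val}\bigl(\prod_{j=0}^{n-1}(s-s_j)\bigr)$ over $s\in S$ (with $s_0\in S$ arbitrary); the number $n!_S:=\mathrm{val}\bigl(\prod_{j=0}^{n-1}(s_n-s_j)\bigr)$ does not depend on the choice of the sequence. The *adelic tree* $T_S$ is the rooted tree with vertex set $\bigsqcup_{h\ge 0}V_h$, where $V_h$ is the image of $S$ in $R/\mathfrak m^h$; its root is the unique element of $V_0$, and $u\in V_h$ and $v\in V_{h+1}$ are adjacent if and only if $v$ maps to $u$. All edges have length one. The subset $S$ is *transient* if the simple random walk on $T_S$ started at the root almost surely visits the root only finitely many times. A *unit flow* on $T_S$ is a function $\theta\ge 0$ on the edges, oriented away from the root, such that the total flow out of the root is $1$ and, at every other vertex, the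 flow in equals the total flow out; its energy is $\sum_e\theta(e)^2$. When $S$ is transient, there is a unique unit flow $\eta$ of minimal energy among those of finite energy (the *unit current flow*), and the *harmonic measure* $\mu_{\mathrm{har}}$ of $S$ is the unique Borel measure on $\overline S$ such that, for every $h\geq 1$ and every $v\in V_h$, the set of $x\in\overline S$ with $x \bmod \mathfrak m^h=v$ has measure equal to the value of $\eta$ on the edge into $v$. Theorem. The following two conditions are equivalent: 1. the subset $S$ is transient; 2. the sequence $\frac1n\, n!_S$ converges to a finite $H(S)\in(0,\infty)$. Moreover, if $S$ is transient, then the harmonic measure $\mu_{\mathrm{har}}$ exists and is unique, every factorial-determining sequence $s_0,s_1,\dots$ of $S$ is equidistributed in $\overline S$ with respect to $\mu_{\mathrm{har}}$ (that is, $\frac1n\sum_{j<n}\delta_{s_j}$ converges weakly to $\mu_{\mathrm{har}}$), and $$H(S)=\int_{\{(x,y)\in\overline S\times\overline S\,:\,x\ne y\}}\mathrm{val}(x-y)\,d\mu_{\mathrm{har}}(x)\,d\mu_{\mathrm{har}}(y) =\int_{\overline S}\mathrm{val}(x_0-y)\,d\mu_{\mathrm{har}}(y)\quad\text{for }\mu_{\mathrm{har}}\text{-almost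 every }x_0\in\overline S.$$ -/

import Mathlib

open MeasureTheory ProbabilityTheory Filter Topology
open scoped ENNReal NNReal ValuativeRel BoundedContinuousFunction

/-! ### Simple random walk on a locally finite graph without isolated vertices -/

section RandomWalk

variable {V : Type*} [MeasurableSpace V] [DiscreteMeasurableSpace V]

/-- Transition kernel of the random walk with unit conductances: from `v`, jump to a uniformly
chosen neighbour of `v`. -/
noncomputable def walkKernel (G : SimpleGraph V) : Kernel V V where
  toFun v := uniformOn (G.neighborSet v)
  measurable' := Measurable.of_discrete

instance (G : SimpleGraph V) [∀ v, Finite (G.neighborSet v)] [∀ v, Nonempty (G.neighborSet v)] :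
    IsMarkovKernel (walkKernel G) :=
  ⟨fun _ => isProbabilityMeasure_uniformOn (Set.toFinite _) Set.Nonempty.of_subtype⟩

/-- Law, on the space of trajectories `ℕ → V`, of the random walk on `G` started at `r`: the
Markov chain with initial state `r` and transition kernel `walkKernel G`. -/
noncomputable def walkLaw (G : SimpleGraph V) [∀ v, Finite (G.neighborSet v)]
    [∀ v, Nonempty (G.neighborSet v)] (r : V) : Measure (ℕ → V) :=
  Kernel.traj (X := fun _ => V)
    (fun n => (walkKernel G).comap (fun x : (i : Finset.Iic n) → V => x ⟨n, by simp⟩)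
      (measurable_pi_apply _)) 0 (fun _ => r)

/-- Almost surely, the walk started at `r` is at `r` only finitely many times. -/
def WalkIsTransient (G : SimpleGraph V) [∀ v, Finite (G.neighborSet v)]
    [∀ v, Nonempty (G.neighborSet v)] (r : V) : Prop :=
  ∀ᵐ X ∂(walkLaw G r), {n : ℕ | X n = r}.Finite

end RandomWalk

/-! ### The adelic tree of a subset of a discrete valuation ring -/

section AdelicTree

variable {R : Type*} [CommRing R] [IsLocalRing R]

/-- Reduction `R → R / 𝔪 ^ h`. -/
abbrev redMod (R : Type*) [CommRing R] [IsLocalRing R] (h : ℕ) :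
    R →+* R ⧸ IsLocalRing.maximalIdeal R ^ h :=
  Ideal.Quotient.mk (IsLocalRing.maximalIdeal R ^ h)

/-- `V_h`: the vertices of generation `h`, i.e. the image of `S` in `R / 𝔪 ^ h`. -/
abbrev AdelicLevel (S : Set R) (h : ℕ) : Type _ := ↥(redMod R h '' S)

/-- The class of `s ∈ S` in `V_h`. -/
def AdelicLevel.of (S : Set R) (h : ℕ) (s : S) : AdelicLevel S h :=
  ⟨redMod R h s, s, s.2, rfl⟩

/-- The projection `V_{h+1} → V_h`. -/
def AdelicLevel.parent {S : Set R} {h : ℕ} (v : AdelicLevel S (h + 1)) : AdelicLevel S h :=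
  ⟨Ideal.Quotient.factorPowSucc (IsLocalRing.maximalIdeal R) h v.1, by
    obtain ⟨_, s, hs, rfl⟩ := v
    exact ⟨s, hs, rfl⟩⟩

/-- The vertex set, the disjoint union of all `V_h`. -/
def AdelicVertex (S : Set R) : Type _ := Σ h : ℕ, AdelicLevel S h

instance (S : Set R) : MeasurableSpace (AdelicVertex S) := ⊤

instance (S : Set R) : DiscreteMeasurableSpace (AdelicVertex S) := ⟨fun _ => trivial⟩

/-- `IsChild u v`: `v ∈ V_{h+1}` lies above `u ∈ V_h` for some `h`. -/
inductive IsChild {S : Set R} : AdelicVertex S → AdelicVertex S → Prop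
  | mk (h : ℕ) (v : AdelicLevel S (h + 1)) : IsChild ⟨h, v.parent⟩ ⟨h + 1, v⟩

/-- The adelic tree `T_S`. -/
def adelicTree (S : Set R) : SimpleGraph (AdelicVertex S) where
  Adj u v := IsChild u v ∨ IsChild v u
  symm := ⟨fun _ _ h => h.symm⟩
  loopless := ⟨by
    have key : ∀ u v : AdelicVertex S, IsChild u v → v.1 = u.1 + 1 := by
      rintro _ _ ⟨h, v⟩
      rfl
    rintro u (h | h) <;> exact absurd (key _ _ h) (by simp)⟩

/-- The root, the unique element of `V_0`. -/
def adelicRoot {S : Set R} (hS : S.Nonempty) : AdelicVertex S :=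
  ⟨0, 0, hS.some, hS.some_mem, (Ideal.Quotient.eq_zero_iff_mem).2 (by simp)⟩

instance (S : Set R) (v : AdelicVertex S) : Nonempty ((adelicTree S).neighborSet v) := by
  obtain ⟨h, _, s, hs, rfl⟩ := v
  exact ⟨⟨h + 1, AdelicLevel.of S (h + 1) ⟨s, hs⟩⟩,
    Or.inl (IsChild.mk h (AdelicLevel.of S (h + 1) ⟨s, hs⟩))⟩

variable [IsNoetherianRing R] [Finite (IsLocalRing.ResidueField R)]

instance (S : Set R) (h : ℕ) : Finite (AdelicLevel S h) := by
  have : Finite (R ⧸ IsLocalRing.maximalIdeal R) :=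
    inferInstanceAs (Finite (IsLocalRing.ResidueField R))
  have : Finite (R ⧸ IsLocalRing.maximalIdeal R ^ h) :=
    Ideal.finite_quotient_pow (IsNoetherian.noetherian _) h
  infer_instance

noncomputable instance (S : Set R) (h : ℕ) : Fintype (AdelicLevel S h) := Fintype.ofFinite _

instance (S : Set R) (v : AdelicVertex S) : Finite ((adelicTree S).neighborSet v) := by
  have key : ∀ u w : AdelicVertex S, IsChild u w → w.1 = u.1 + 1 := by
    rintro _ _ ⟨h, _⟩
    rfl
  let f : (Σ h : Fin (v.1 + 2), AdelicLevel S h) → AdelicVertex S := fun x => ⟨x.1, x.2⟩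
  refine Set.Finite.to_subtype ((Set.finite_range f).subset ?_)
  rintro w (hw | hw)
  · have := key _ _ hw
    exact ⟨⟨⟨w.1, by omega⟩, w.2⟩, rfl⟩
  · have := key _ _ hw
    exact ⟨⟨⟨w.1, by omega⟩, w.2⟩, rfl⟩

/-- `S` is transient if the random walk on its adelic tree (all edges have length one), started
at the root, is transient. -/
def IsTransientSubset (S : Set R) (hS : S.Nonempty) : Prop :=
  WalkIsTransient (adelicTree S) (adelicRoot hS)

/-! ### Flows and the harmonic measure -/

open Classical in
/-- The edge from `v.parent` to `v ∈ V_{h+1}` is recorded by its endpoint `v`, so that a function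
on the oriented edges is a family `θ h : V_{h+1} → ℝ≥0`. It is a unit flow if it has total
amount one out of the root and is conserved at all other vertices. -/
structure IsUnitFlow (S : Set R) (θ : (h : ℕ) → AdelicLevel S (h + 1) → ℝ≥0) : Prop where
  total : ∑ v, θ 0 v = 1
  conserved : ∀ (h : ℕ) (v : AdelicLevel S (h + 1)),
    θ h v = ∑ u : AdelicLevel S (h + 2) with u.parent = v, θ (h + 1) u

/-- The energy of a function on the edges of `T_S`, for the length function identically one. -/
noncomputable def flowEnergy {S : Set R} (θ : (h : ℕ) → AdelicLevel S (h + 1) → ℝ≥0) : ℝ≥0∞ :=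
  ∑' h, ∑ v, (θ h v : ℝ≥0∞) ^ 2

/-- The unit current flow: the unit flow of bounded and minimal energy. -/
structure IsUnitCurrentFlow (S : Set R) (η : (h : ℕ) → AdelicLevel S (h + 1) → ℝ≥0) :
    Prop where
  unitFlow : IsUnitFlow S η
  bounded : flowEnergy η < ∞
  minimal : ∀ θ, IsUnitFlow S θ → flowEnergy η ≤ flowEnergy θ

/-- Harmonic measure, carried over to the closure of `S` by the identification of an infinite path
`(v_h)` from the root with the element of the closure reducing to `v_h` modulo `𝔪 ^ h` for all `h`:
the set of paths through `v` has as its mass the unit current flow through the edge into `v`. -/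
def IsHarmonicMeasure [TopologicalSpace R] [MeasurableSpace R] (S : Set R)
    (μ : Measure (closure S)) : Prop :=
  ∃ η, IsUnitCurrentFlow S η ∧ ∀ (h : ℕ) (v : AdelicLevel S (h + 1)),
    μ {x : closure S | redMod R (h + 1) x = v.1} = η h v

end AdelicTree

/-! ### Factorials -/

section Factorial

open IsDiscreteValuationRing Finset

variable {R : Type*} [CommRing R] [IsDomain R] [IsDiscreteValuationRing R]

/-- A factorial-determining sequence of `S`: each `s n` is an element of `S` that minimizes the
valuation of `∏_{j < n} (x - s j)` among all `x ∈ S`. -/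
structure IsFactorialDetermining (S : Set R) (s : ℕ → R) : Prop where
  mem : ∀ n, s n ∈ S
  minimal : ∀ n, ∀ x ∈ S, addVal R (∏ j ∈ range n, (s n - s j)) ≤
    addVal R (∏ j ∈ range n, (x - s j))

/-- The logarithmic factorial of `n` associated to `S`: the valuation of `∏_{j < n} (s n - s j)`
for a factorial-determining sequence `s` of `S`. All such sequences give the same value, see
`subsetFactorial_eq`; one exists as soon as `S` is nonempty. -/
noncomputable def subsetFactorial (S : Set R) (n : ℕ) : ℕ∞ :=
  ⨅ (s : ℕ → R) (_ : IsFactorialDetermining S s), addVal R (∏ j ∈ range n, (s n - s j))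

theorem exists_isFactorialDetermining {S : Set R} (hS : S.Nonempty) :
    ∃ s, IsFactorialDetermining S s := by
  have step : ∀ (n : ℕ) (f : ℕ → R), ∃ x ∈ S, ∀ y ∈ S,
      addVal R (∏ j ∈ range n, (x - f j)) ≤ addVal R (∏ j ∈ range n, (y - f j)) := by
    intro n f
    exact ⟨Function.argminOn (fun x => addVal R (∏ j ∈ range n, (x - f j))) S hS,
      Function.argminOn_mem _ _ _, fun y hy =>
        Function.argminOn_le (fun x => addVal R (∏ j ∈ range n, (x - f j))) S hy⟩
  choose g hg hmin using step
  let F : (n : ℕ) → ((m : ℕ) → m < n → R) → R :=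
    fun n ih => g n (fun j => if h : j < n then ih j h else 0)
  let s : ℕ → R := fun n => Nat.lt_wfRel.wf.fix F n
  have hs : ∀ n, s n = g n (fun j => if j < n then s j else 0) := by
    intro n
    change Nat.lt_wfRel.wf.fix F n = _
    rw [WellFounded.fix_eq]
    simp only [F, dite_eq_ite, s]
  have hc : ∀ n (x : R), ∏ j ∈ range n, (x - if j < n then s j else 0)
      = ∏ j ∈ range n, (x - s j) := by
    intro n x
    refine prod_congr rfl fun j hj => ?_
    rw [if_pos (mem_range.1 hj)]
  refine ⟨s, fun n => by rw [hs]; exact hg _ _, fun n x hx => ?_⟩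
  have := hmin n (fun j => if j < n then s j else 0) x hx
  rw [← hs, hc, hc] at this
  exact this

theorem IsFactorialDetermining.dvd {S : Set R} {s t : ℕ → R} (hs : IsFactorialDetermining S s)
    (ht : IsFactorialDetermining S t) (n : ℕ) :
    ∏ j ∈ range n, (t n - t j) ∣ ∏ j ∈ range n, (s n - s j) := by
  have expand : ∀ n, ∃ c : ℕ → R, ∀ x, ∏ j ∈ range n, (x - t j) =
      ∑ k ∈ range n, c k * ∏ j ∈ range k, (x - s j) + ∏ j ∈ range n, (x - s j) := by
    intro n
    induction n with
    | zero => exact ⟨0, by simp⟩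
    | succ n ih =>
      obtain ⟨c, hc⟩ := ih
      let c' : ℕ → R := fun k => if k < n then c k else 1
      have hc' : ∀ x, ∏ j ∈ range n, (x - t j) =
          ∑ k ∈ range (n + 1), c' k * ∏ j ∈ range k, (x - s j) := by
        intro x
        rw [hc, sum_range_succ]
        congr 1
        · refine sum_congr rfl fun k hk => ?_
          simp [c', mem_range.1 hk]
        · simp [c']
      refine ⟨fun k => (if k = 0 then 0 else c' (k - 1)) + c' k * (s k - t n), fun x => ?_⟩
      have h1 : ∏ j ∈ range (n + 1), (x - t j) =
          ∑ k ∈ range (n + 1), c' k * ∏ j ∈ range (k + 1), (x - s j) +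
          ∑ k ∈ range (n + 1), c' k * (s k - t n) * ∏ j ∈ range k, (x - s j) := by
        rw [prod_range_succ, hc', sum_mul, ← sum_add_distrib]
        refine sum_congr rfl fun k _ => ?_
        rw [prod_range_succ]
        ring
      rw [h1, sum_range_succ (fun k => c' k * ∏ j ∈ range (k + 1), (x - s j))]
      have h2 : ∑ k ∈ range (n + 1), ((if k = 0 then 0 else c' (k - 1)) + c' k * (s k - t n)) *
          ∏ j ∈ range k, (x - s j) = ∑ k ∈ range n, c' k * ∏ j ∈ range (k + 1), (x - s j) +
          ∑ k ∈ range (n + 1), c' k * (s k - t n) * ∏ j ∈ range k, (x - s j) := by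
        simp only [add_mul, sum_add_distrib]
        congr 1
        rw [sum_range_succ']
        simp
      rw [h2]
      have : c' n = 1 := by simp [c']
      rw [this]
      ring
  obtain ⟨c, hc⟩ := expand n
  set d := ∏ j ∈ range n, (t n - t j) with hd
  have hdS : ∀ x ∈ S, d ∣ ∏ j ∈ range n, (x - t j) := fun x hx =>
    addVal_le_iff_dvd.1 (ht.minimal n x hx)
  have hsS : ∀ k, ∀ x ∈ S, ∏ j ∈ range k, (s k - s j) ∣ ∏ j ∈ range k, (x - s j) :=
    fun k x hx => addVal_le_iff_dvd.1 (hs.minimal k x hx)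
  have main : ∀ k, k < n → d ∣ c k * ∏ j ∈ range k, (s k - s j) := by
    intro k
    induction k using Nat.strong_induction_on with
    | _ k ih =>
      intro hk
      have h := hdS (s k) (hs.mem k)
      rw [hc] at h
      have hz : ∀ m, k < m → ∏ j ∈ range m, (s k - s j) = 0 := fun m hm =>
        prod_eq_zero (mem_range.2 hm) (sub_self _)
      rw [hz n hk, add_zero, ← sum_subset (range_subset_range.2 hk : range (k + 1) ⊆ range n)
        (fun m _ hm => by rw [hz m (by simpa using hm), mul_zero]), sum_range_succ] at h
      refine (dvd_add_right ?_).1 h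
      exact dvd_sum fun i hi => (ih i (mem_range.1 hi) ((mem_range.1 hi).trans hk)).trans
        (mul_dvd_mul_left _ (hsS i _ (hs.mem k)))
  have h := hdS (s n) (hs.mem n)
  rw [hc] at h
  refine (dvd_add_right ?_).1 h
  exact dvd_sum fun i hi => (main i (mem_range.1 hi)).trans
    (mul_dvd_mul_left _ (hsS i _ (hs.mem n)))

/-- The factorials do not depend on the factorial-determining sequence. -/
theorem subsetFactorial_eq {S : Set R} {s : ℕ → R} (hs : IsFactorialDetermining S s) (n : ℕ) :
    subsetFactorial S n = addVal R (∏ j ∈ range n, (s n - s j)) :=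
  le_antisymm (iInf₂_le s hs) (le_iInf₂ fun _ ht => addVal_le_iff_dvd.2 (ht.dvd hs n))

open Classical in
/-- The factorials of an infinite subset are finite. -/
theorem subsetFactorial_ne_top {S : Set R} (hS : S.Infinite) (n : ℕ) :
    subsetFactorial S n ≠ ⊤ := by
  obtain ⟨s, hs⟩ := exists_isFactorialDetermining hS.nonempty
  obtain ⟨x, hx, hxs⟩ := hS.exists_notMem_finset ((range n).image s)
  rw [subsetFactorial_eq hs]
  refine ne_top_of_le_ne_top ?_ (hs.minimal n x hx)
  rw [Ne, addVal_eq_top_iff, prod_eq_zero_iff]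
  rintro ⟨j, hj, h⟩
  exact hxs (mem_image.2 ⟨j, hj, (sub_eq_zero.1 h).symm⟩)

end Factorial

/-- The sequence `x` is equidistributed with respect to `μ`: the averages of the Dirac masses at
`x 0, …, x (n - 1)` converge weakly to `μ`. -/
def IsEquidistributed {X : Type*} [TopologicalSpace X] [MeasurableSpace X] (μ : Measure X)
    (x : ℕ → X) : Prop :=
  ∀ f : X →ᵇ ℝ, Tendsto (fun n : ℕ => (∑ j ∈ Finset.range n, f (x j)) / n) atTop
    (𝓝 (∫ y, f y ∂μ))

/-! ### Hitting probabilities and recurrence of the random walk -/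

section RandomWalkRecurrence

set_option linter.unusedSectionVars false

variable {V : Type*} [MeasurableSpace V] [DiscreteMeasurableSpace V]
  (G : SimpleGraph V) [∀ v, Finite (G.neighborSet v)] [∀ v, Nonempty (G.neighborSet v)]

/-! The valuation of `x - y` is the number of levels `h ≥ 1` at which `x` and `y` have the same
class. So a sum of valuations of differences is a sum of masses along a path of the tree, and the
energy of a flow is the double integral of `val (x - y)` against the measure it defines.
Factorial-determining sequences minimize a discrete form of this energy greedily, and the unit
current flow minimizes it among all unit flows. The theorem compares the two minimizations.

Transience means that a unit flow of finite energy exists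
(`isTransientSubset_iff_exists_isUnitFlow`). In one direction the flow is the normalized gradient of
the probability of hitting the root. In the other, compactness gives a minimizer `η`, of energy `E`.
Perturbing `η` towards its own part through a given vertex shows that its sum along every path is at
most `E` (`IsUnitCurrentFlow.pathFlow_le`), so `E` minus this sum is nonnegative, harmonic off the
root and strictly superharmonic there.

For the growth of the factorials, `n!_S ≤ ∑ val (x - s j)` holds for every `x ∈ S`. Averaging over
`x` with weights `η` turns each summand into a path sum, hence `n!_S ≤ n E`
(`IsUnitCurrentFlow.subsetFactorial_le`). Conversely, if `n!_S ≤ n L` for all `n`, then adding up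
these bounds controls the energy of the empirical flows of the sequence, and their limits are unit
flows of energy at most `L` (`flowEnergy_le_of_tendsto_empiricalFlow`). Superadditivity provides the
limit `L` of `n!_S / n`, and so `L = E`.

Each limit of the empirical flows therefore has minimal energy, and by strict convexity it equals
`η`; this is equidistribution. Finally, the potential of the harmonic measure is at most `E`
everywhere and has mean `E`, so it equals `E` almost everywhere. -/

theorem measurableSet_eval_eq {ι : Type*} (i : ι) (r : V) :
    MeasurableSet {x : ι → V | x i = r} := by
  have h : MeasurableSet ((fun x : ι → V => x i) ⁻¹' {r}) :=
    measurable_pi_apply i MeasurableSet.of_discrete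
  exact h

theorem measurableSet_eval_ne {ι : Type*} (i : ι) (r : V) :
    MeasurableSet {x : ι → V | x i ≠ r} := by
  have h : MeasurableSet ((fun x : ι → V => x i) ⁻¹' {r}ᶜ) :=
    measurable_pi_apply i MeasurableSet.of_discrete
  exact h

instance (r : V) : IsProbabilityMeasure (walkLaw G r) := by
  unfold walkLaw
  infer_instance

/-- The Markov property at time `n`, with `A` an event of the past. It is read off from the
description of the law up to time `n + 1` as a composition-product with the kernel. -/
theorem setLIntegral_walkLaw_succ (r : V) (n : ℕ) {A : Set ((i : Finset.Iic n) → V)}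
    (hA : MeasurableSet A) (g : V → ℝ≥0∞) :
    ∫⁻ X in Preorder.frestrictLe (π := fun _ => V) n ⁻¹' A, g (X (n + 1)) ∂walkLaw G r =
      ∫⁻ X in Preorder.frestrictLe (π := fun _ => V) n ⁻¹' A,
        (∫⁻ w, g w ∂walkKernel G (X n)) ∂walkLaw G r := by
  let κ : (n : ℕ) → Kernel ((i : Finset.Iic n) → V) V :=
    fun n => (walkKernel G).comap (fun x : (i : Finset.Iic n) → V => x ⟨n, by simp⟩)
      (measurable_pi_apply _)
  have hg : Measurable g := Measurable.of_discrete
  have hP : Measurable fun v => ∫⁻ w, g w ∂walkKernel G v := Measurable.of_discrete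
  have hfr : Measurable (Preorder.frestrictLe (π := fun _ : ℕ => V) n) := by fun_prop
  have key := Kernel.partialTraj_compProd_eq_map_traj (X := fun _ => V) (κ := κ)
    (Nat.zero_le n) (x₀ := fun _ => r)
  have hm : Measurable fun p : ((i : Finset.Iic n) → V) × V => A.indicator 1 p.1 * g p.2 :=
    ((measurable_one.indicator hA).comp measurable_fst).mul (hg.comp measurable_snd)
  have h1 := congrArg (fun μ => ∫⁻ p, A.indicator 1 p.1 * g p.2 ∂μ) key
  rw [lintegral_map hm (by fun_prop), Measure.lintegral_compProd hm] at h1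
  have h2 : ∀ x : (i : Finset.Iic n) → V, ∫⁻ b, A.indicator 1 x * g b ∂κ n x =
      A.indicator 1 x * ∫⁻ w, g w ∂walkKernel G (x ⟨n, by simp⟩) := fun x => by
    rw [lintegral_const_mul _ hg]
    rfl
  simp only [h2] at h1
  have hm' : Measurable fun x : (i : Finset.Iic n) → V =>
      A.indicator 1 x * ∫⁻ w, g w ∂walkKernel G (x ⟨n, by simp⟩) :=
    (measurable_one.indicator hA).mul (hP.comp (measurable_pi_apply _))
  rw [← Kernel.traj_map_frestrictLe_apply, lintegral_map hm' hfr] at h1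
  have h3 : ∀ (F : (ℕ → V) → ℝ≥0∞), ∫⁻ X in Preorder.frestrictLe (π := fun _ => V) n ⁻¹' A, F X
      ∂walkLaw G r = ∫⁻ X, A.indicator 1 (Preorder.frestrictLe (π := fun _ => V) n X) * F X
        ∂walkLaw G r := fun F => by
    rw [← lintegral_indicator (hfr hA)]
    congr 1 with X
    by_cases hX : Preorder.frestrictLe (π := fun _ => V) n X ∈ A <;> simp [Set.indicator, hX]
  rw [h3, h3]
  exact h1.symm

theorem ae_walkLaw_zero (r : V) : ∀ᵐ X ∂walkLaw G r, X 0 = r := by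
  have h : (walkLaw G r).map (Preorder.frestrictLe (π := fun _ => V) 0) =
      Measure.dirac fun _ => r := by
    unfold walkLaw
    rw [Kernel.traj_map_frestrictLe_apply, Kernel.partialTraj_self, Kernel.id_apply]
  have hs : MeasurableSet {x : (i : Finset.Iic 0) → V | x ⟨0, by simp⟩ = r} :=
    measurableSet_eval_eq (⟨0, by simp⟩ : Finset.Iic 0) r
  have h2 : ∀ᵐ x ∂(walkLaw G r).map (Preorder.frestrictLe (π := fun _ => V) 0),
      x ⟨0, by simp⟩ = r := by
    rw [h, ae_dirac_iff hs]
  exact ae_of_ae_map (by fun_prop) h2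

/-- If some function is superharmonic with a definite loss at the root, then the walk is
transient. -/
theorem walkIsTransient_of_superharmonic {r : V} {g : V → ℝ≥0∞} {c : ℝ≥0∞} (hc : c ≠ 0)
    (hr : g r ≠ ∞) (hg : ∀ v, ∫⁻ w, g w ∂walkKernel G v ≤ g v)
    (hgr : ∫⁻ w, g w ∂walkKernel G r + c ≤ g r) : WalkIsTransient G r := by
  have hms : ∀ n, MeasurableSet {X : ℕ → V | X n = r} := fun n =>
    measurableSet_eval_eq n r
  have hmg : ∀ n, Measurable fun X : ℕ → V => g (X n) := fun n =>
    (Measurable.of_discrete (f := g)).comp (measurable_pi_apply n)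
  -- The mean of `g (X n)` drops at time `n` by at least `c` times the probability of being at `r`.
  -- Hence the expected number of visits is at most `g r / c`.
  have step : ∀ n, ∫⁻ X, g (X (n + 1)) ∂walkLaw G r + c * walkLaw G r {X | X n = r} ≤
      ∫⁻ X, g (X n) ∂walkLaw G r := by
    intro n
    have h1 := setLIntegral_walkLaw_succ G r n MeasurableSet.univ g
    simp only [Set.preimage_univ, Measure.restrict_univ] at h1
    rw [h1, ← lintegral_indicator_const (hms n),
      ← lintegral_add_right _ (measurable_const.indicator (hms n))]
    refine lintegral_mono fun X => ?_
    by_cases hX : X n = r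
    · simpa [Set.indicator, hX] using hgr
    · simpa [Set.indicator, hX] using hg _
  have sums : ∀ n, ∫⁻ X, g (X n) ∂walkLaw G r +
      ∑ k ∈ Finset.range n, c * walkLaw G r {X | X k = r} ≤ g r := by
    intro n
    induction n with
    | zero =>
      have : ∫⁻ X, g (X 0) ∂walkLaw G r = ∫⁻ _, g r ∂walkLaw G r :=
        lintegral_congr_ae ((ae_walkLaw_zero G r).mono fun X hX => by simp [hX])
      simp [this]
    | succ n ih =>
      rw [Finset.sum_range_succ, add_comm (∑ k ∈ _, _), ← add_assoc]
      exact (add_le_add_left (step n) _).trans ih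
  have hsum : c * ∑' n, walkLaw G r {X | X n = r} ≤ g r := by
    rw [← ENNReal.tsum_mul_left, ENNReal.tsum_eq_iSup_nat]
    exact iSup_le fun n => le_add_self.trans (sums n)
  -- Borel–Cantelli.
  refine ae_finite_setOfPred_mem (s := fun n => {X : ℕ → V | X n = r}) ?_
  intro htop
  rw [htop, ENNReal.mul_top hc] at hsum
  exact hr (top_le_iff.1 hsum)

open Classical in
/-- The probability of visiting `r` within the first `m` steps. -/
noncomputable def hitWithin (r : V) : ℕ → V → ℝ≥0∞
  | 0, v => if v = r then 1 else 0
  | m + 1, v => if v = r then 1 else ∫⁻ w, hitWithin r m w ∂walkKernel G v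

/-- The probability of ever visiting `r`. -/
noncomputable def hitProb (r v : V) : ℝ≥0∞ := ⨆ m, hitWithin G r m v

@[simp]
theorem hitWithin_self (r : V) (m : ℕ) : hitWithin G r m r = 1 := by
  cases m <;> simp [hitWithin]

@[simp]
theorem hitProb_self (r : V) : hitProb G r r = 1 := by simp [hitProb]

theorem hitWithin_succ_of_ne {r v : V} (h : v ≠ r) (m : ℕ) :
    hitWithin G r (m + 1) v = ∫⁻ w, hitWithin G r m w ∂walkKernel G v := by
  simp [hitWithin, h]

theorem hitWithin_le_succ (r : V) (m : ℕ) (v : V) :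
    hitWithin G r m v ≤ hitWithin G r (m + 1) v := by
  induction m generalizing v with
  | zero =>
    by_cases h : v = r
    · simp [h]
    · simp [hitWithin, h]
  | succ m ih =>
    by_cases h : v = r
    · simp [h]
    · rw [hitWithin_succ_of_ne G h, hitWithin_succ_of_ne G h]
      exact lintegral_mono ih

theorem monotone_hitWithin (r : V) : Monotone (hitWithin G r) :=
  monotone_nat_of_le_succ fun m v => hitWithin_le_succ G r m v

theorem hitProb_of_ne {r v : V} (h : v ≠ r) :
    hitProb G r v = ∫⁻ w, hitProb G r w ∂walkKernel G v := by
  have : ∫⁻ w, hitProb G r w ∂walkKernel G v =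
      ⨆ m, ∫⁻ w, hitWithin G r m w ∂walkKernel G v := by
    unfold hitProb
    exact lintegral_iSup (fun _ => Measurable.of_discrete) (monotone_hitWithin G r)
  rw [this]
  refine le_antisymm (iSup_le fun m => ?_) (iSup_le fun m => ?_)
  · refine (hitWithin_le_succ G r m v).trans ?_
    rw [hitWithin_succ_of_ne G h]
    exact le_iSup (fun m => ∫⁻ w, hitWithin G r m w ∂walkKernel G v) m
  · rw [← hitWithin_succ_of_ne G h]
    exact le_iSup (fun m => hitWithin G r m v) (m + 1)

/-- The hitting probability is the smallest nonnegative function that is at least one at `r` and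
superharmonic elsewhere. -/
theorem hitProb_le_of_superharmonic {r : V} {W : V → ℝ≥0∞} (hr : 1 ≤ W r)
    (hW : ∀ v, v ≠ r → ∫⁻ w, W w ∂walkKernel G v ≤ W v) (v : V) : hitProb G r v ≤ W v := by
  refine iSup_le fun m => ?_
  induction m generalizing v with
  | zero =>
    by_cases h : v = r
    · simpa [h] using hr
    · simp [hitWithin, h]
  | succ m ih =>
    by_cases h : v = r
    · simpa [h] using hr
    · rw [hitWithin_succ_of_ne G h]
      exact (lintegral_mono ih).trans (hW v h)

theorem hitProb_le_one (r v : V) : hitProb G r v ≤ 1 :=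
  hitProb_le_of_superharmonic G (W := fun _ => 1) le_rfl (fun v _ => by simp) v

/-- Ties the recursively defined `hitWithin` to trajectories. The induction on `m` splits according
to whether `X n = r`; off `r`, the Markov property passes to time `n + 1`. -/
theorem walkLaw_inter_exists_visit (r₀ r : V) (m : ℕ) (n : ℕ) {A : Set ((i : Finset.Iic n) → V)}
    (hA : MeasurableSet A) :
    walkLaw G r₀ (Preorder.frestrictLe (π := fun _ => V) n ⁻¹' A ∩
        {X | ∃ k ≤ m, X (n + k) = r}) =
      ∫⁻ X in Preorder.frestrictLe (π := fun _ => V) n ⁻¹' A, hitWithin G r m (X n)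
        ∂walkLaw G r₀ := by
  classical
  have hms : ∀ n, MeasurableSet {X : ℕ → V | X n = r} := fun n =>
    measurableSet_eval_eq n r
  induction m generalizing n A with
  | zero =>
    have h1 : ∀ X : ℕ → V, hitWithin G r 0 (X n) = {X : ℕ → V | X n = r}.indicator 1 X := by
      intro X
      simp [hitWithin, Set.indicator]
    simp only [h1]
    rw [lintegral_indicator_one (hms n), Measure.restrict_apply (hms n), Set.inter_comm]
    simp
  | succ m ih =>
    have hAr : MeasurableSet (A ∩ {x | x ⟨n, by simp⟩ = r}) := hA.inter
      (measurableSet_eval_eq (⟨n, by simp⟩ : Finset.Iic n) r)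
    set F := Preorder.frestrictLe (π := fun _ : ℕ => V) n ⁻¹' A with hF
    have hFm : MeasurableSet F := (by fun_prop : Measurable _) hA
    -- The event `A` together with `X n ≠ r`, seen as an event of the past of time `n + 1`.
    let A' : Set ((i : Finset.Iic (n + 1)) → V) :=
      {x | (fun i : Finset.Iic n => x ⟨i, by
        have := Finset.mem_Iic.1 i.2; simp; omega⟩) ∈ A ∧ x ⟨n, by simp⟩ ≠ r}
    have hA' : MeasurableSet A' := by
      refine MeasurableSet.inter ?_ ?_
      · exact (measurable_pi_lambda _ fun i => measurable_pi_apply _ :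
          Measurable fun (x : (i : Finset.Iic (n + 1)) → V) (i : Finset.Iic n) =>
            x ⟨i, by have := Finset.mem_Iic.1 i.2; simp; omega⟩) hA
      · exact (measurableSet_eval_ne (⟨n, by simp⟩ : Finset.Iic (n + 1)) r)
    have hA'F : Preorder.frestrictLe (π := fun _ : ℕ => V) (n + 1) ⁻¹' A' =
        F ∩ {X | X n = r}ᶜ := rfl
    have hA'G : Preorder.frestrictLe (π := fun _ : ℕ => V) n ⁻¹' (A ∩ {x | x ⟨n, by simp⟩ ≠ r}) =
        F ∩ {X | X n = r}ᶜ := rfl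
    rw [← measure_inter_add_sdiff _ (hms n), ← lintegral_inter_add_sdiff _ F (hms n)]
    congr 1
    · have h1 : F ∩ {X : ℕ → V | ∃ k ≤ m + 1, X (n + k) = r} ∩ {X | X n = r} =
          F ∩ {X | X n = r} := by
        ext X
        simp only [Set.mem_inter_iff, Set.mem_ofPred_eq]
        exact ⟨fun h => ⟨h.1.1, h.2⟩, fun h => ⟨⟨h.1, 0, by omega, h.2⟩, h.2⟩⟩
      rw [h1]
      have h2 : ∫⁻ X in F ∩ {X | X n = r}, hitWithin G r (m + 1) (X n) ∂walkLaw G r₀ =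
          ∫⁻ X in F ∩ {X | X n = r}, 1 ∂walkLaw G r₀ :=
        setLIntegral_congr_fun (hFm.inter (hms n)) fun X hX => by
          simp [show X n = r from hX.2]
      rw [h2, setLIntegral_one]
    · have h1 : (F ∩ {X : ℕ → V | ∃ k ≤ m + 1, X (n + k) = r}) \ {X | X n = r} =
          Preorder.frestrictLe (π := fun _ : ℕ => V) (n + 1) ⁻¹' A' ∩
            {X | ∃ k ≤ m, X (n + 1 + k) = r} := by
        rw [hA'F]
        ext X
        simp only [Set.mem_inter_iff, Set.mem_ofPred_eq, Set.mem_sdiff, Set.mem_compl_iff]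
        constructor
        · rintro ⟨⟨h1, k, hk, hX⟩, h2⟩
          obtain _ | k := k
          · exact absurd hX h2
          · exact ⟨⟨h1, h2⟩, k, by omega, by rwa [show n + 1 + k = n + (k + 1) by omega]⟩
        · rintro ⟨⟨h1, h2⟩, k, hk, hX⟩
          exact ⟨⟨h1, k + 1, by omega, by rwa [show n + (k + 1) = n + 1 + k by omega]⟩, h2⟩
      rw [h1, ih (n + 1) hA', hA'F, ← hA'G, setLIntegral_walkLaw_succ G r₀ n
        (hA.inter (measurableSet_eval_ne (⟨n, by simp⟩ : Finset.Iic n) r)), hA'G]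
      refine setLIntegral_congr_fun (hFm.inter (hms n).compl) fun X hX => ?_
      exact (hitWithin_succ_of_ne G hX.2 m).symm

/-- If the walk is transient, then with positive probability it never comes back. -/
theorem lintegral_hitProb_lt_one {r : V} (h : WalkIsTransient G r) :
    ∫⁻ w, hitProb G r w ∂walkKernel G r < 1 := by
  classical
  by_contra hcon
  have h1 : 1 ≤ ∫⁻ w, hitProb G r w ∂walkKernel G r := not_lt.1 hcon
  have hms : ∀ n, MeasurableSet {X : ℕ → V | X n = r} := fun n =>
    measurableSet_eval_eq n r
  have hev : ∀ n, MeasurableSet {X : ℕ → V | ∃ k, X (n + 1 + k) = r} := fun n => by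
    rw [show {X : ℕ → V | ∃ k, X (n + 1 + k) = r} = ⋃ k, {X : ℕ → V | X (n + 1 + k) = r} by
      ext; simp]
    exact MeasurableSet.iUnion fun k => hms _
  -- With return probability one, almost surely every visit is followed by a later one, so there is
  -- no last visit.
  have hret : ∀ n, ∀ᵐ X ∂walkLaw G r, X n = r → ∃ k, X (n + 1 + k) = r := by
    intro n
    let A : Set ((i : Finset.Iic n) → V) := {x | x ⟨n, by simp⟩ = r}
    have hA : MeasurableSet A :=
      measurableSet_eval_eq (⟨n, by simp⟩ : Finset.Iic n) r
    let A' : Set ((i : Finset.Iic (n + 1)) → V) := {x | x ⟨n, by simp⟩ = r}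
    have hA' : MeasurableSet A' :=
      measurableSet_eval_eq (⟨n, by simp⟩ : Finset.Iic (n + 1)) r
    have hm : ∀ m, walkLaw G r {X | X n = r} * ∫⁻ w, hitWithin G r m w ∂walkKernel G r ≤
        walkLaw G r ({X | X n = r} ∩ {X | ∃ k, X (n + 1 + k) = r}) := by
      intro m
      have e1 := walkLaw_inter_exists_visit G r r m (n + 1) hA'
      have e2 := setLIntegral_walkLaw_succ G r n hA (hitWithin G r m)
      have e3 : ∫⁻ X in {X : ℕ → V | X n = r}, (∫⁻ w, hitWithin G r m w ∂walkKernel G (X n))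
          ∂walkLaw G r = ∫⁻ X in {X : ℕ → V | X n = r},
            (∫⁻ w, hitWithin G r m w ∂walkKernel G r) ∂walkLaw G r :=
        setLIntegral_congr_fun (hms n) fun X hX => by
          simp [show X n = r from hX]
      rw [setLIntegral_const, mul_comm] at e3
      rw [← e3]
      refine (e2.symm.trans e1.symm).le.trans (measure_mono ?_)
      rintro X ⟨hX, k, -, hk⟩
      exact ⟨hX, k, hk⟩
    have hsup : walkLaw G r {X | X n = r} * ∫⁻ w, hitProb G r w ∂walkKernel G r ≤
        walkLaw G r ({X | X n = r} ∩ {X | ∃ k, X (n + 1 + k) = r}) := by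
      unfold hitProb
      rw [lintegral_iSup (fun _ => Measurable.of_discrete) (monotone_hitWithin G r),
        ENNReal.mul_iSup]
      exact iSup_le hm
    have hle : walkLaw G r {X | X n = r} ≤
        walkLaw G r ({X | X n = r} ∩ {X | ∃ k, X (n + 1 + k) = r}) :=
      (le_mul_of_one_le_right zero_le h1).trans hsup
    have hz : walkLaw G r ({X | X n = r} \ {X | ∃ k, X (n + 1 + k) = r}) = 0 := by
      rw [← Set.sdiff_inter_self_eq_sdiff, Set.inter_comm, measure_sdiff Set.inter_subset_left
        ((hms n).inter (hev n)).nullMeasurableSet (measure_ne_top _ _)]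
      exact tsub_eq_zero_of_le hle
    refine measure_mono_null (fun X hX => ?_) hz
    simp only [Set.mem_compl_iff, Set.mem_ofPred_eq, not_forall] at hX
    exact ⟨hX.1, hX.2⟩
  have hF : ∀ᵐ X ∂walkLaw G r, False := by
    filter_upwards [h, ae_all_iff.2 hret, ae_walkLaw_zero G r] with X hX hret h0
    obtain ⟨n, hn, hmax⟩ := hX.exists_maximal ⟨0, h0⟩
    obtain ⟨k, hk⟩ := hret n hn
    have := hmax hk (by omega : n ≤ n + 1 + k)
    omega
  have : walkLaw G r = 0 := by simpa using hF
  exact IsProbabilityMeasure.ne_zero (walkLaw G r) this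

end RandomWalkRecurrence

/-! ### The neighbours in the adelic tree -/

section AdelicTreeWalk

set_option linter.unusedSectionVars false

variable {R : Type*} [CommRing R] [IsLocalRing R] {S : Set R}

theorem AdelicLevel.of_eq_of_iff {h : ℕ} {s t : S} :
    AdelicLevel.of S h s = AdelicLevel.of S h t ↔
      (s : R) - t ∈ IsLocalRing.maximalIdeal R ^ h := by
  rw [← Ideal.Quotient.eq]
  exact Subtype.ext_iff

theorem AdelicLevel.of_surjective (h : ℕ) : Function.Surjective (AdelicLevel.of S h) := by
  rintro ⟨_, s, hs, rfl⟩
  exact ⟨⟨s, hs⟩, rfl⟩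

@[simp]
theorem AdelicLevel.parent_of (h : ℕ) (s : S) :
    (AdelicLevel.of S (h + 1) s).parent = AdelicLevel.of S h s := rfl

theorem AdelicLevel.of_eq_of_le {h k : ℕ} (hk : h ≤ k) {s t : S}
    (hst : AdelicLevel.of S k s = AdelicLevel.of S k t) :
    AdelicLevel.of S h s = AdelicLevel.of S h t :=
  AdelicLevel.of_eq_of_iff.2 (Ideal.pow_le_pow_right hk (AdelicLevel.of_eq_of_iff.1 hst))

instance : Subsingleton (AdelicLevel S 0) := by
  refine ⟨fun u v => ?_⟩
  obtain ⟨s, rfl⟩ := AdelicLevel.of_surjective 0 u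
  obtain ⟨t, rfl⟩ := AdelicLevel.of_surjective 0 v
  exact AdelicLevel.of_eq_of_iff.2 (by simp)

/-- The vertex given by an element of `V_h`. -/
def AdelicVertex.mk (h : ℕ) (v : AdelicLevel S h) : AdelicVertex S := ⟨h, v⟩

theorem AdelicVertex.mk_injective (h : ℕ) :
    Function.Injective (AdelicVertex.mk (S := S) h) := sigma_mk_injective

theorem AdelicVertex.eq_of_mk_eq_mk {h k : ℕ} {v : AdelicLevel S h} {w : AdelicLevel S k}
    (heq : AdelicVertex.mk h v = AdelicVertex.mk k w) : h = k := (Sigma.mk.inj_iff.1 heq).1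

theorem AdelicVertex.exists_eq_mk (v : AdelicVertex S) :
    ∃ (h : ℕ) (w : AdelicLevel S h), v = AdelicVertex.mk h w := ⟨v.1, v.2, rfl⟩

theorem AdelicVertex.mk_zero_eq_adelicRoot (hS : S.Nonempty) (v : AdelicLevel S 0) :
    AdelicVertex.mk 0 v = adelicRoot hS :=
  congrArg (AdelicVertex.mk 0) (Subsingleton.elim v (adelicRoot hS).2)

theorem isChild_iff {u v : AdelicVertex S} : IsChild u v ↔ ∃ (h : ℕ) (w : AdelicLevel S (h + 1)),
    u = AdelicVertex.mk h w.parent ∧ v = AdelicVertex.mk (h + 1) w := by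
  constructor
  · rintro ⟨h, w⟩
    exact ⟨h, w, rfl, rfl⟩
  · rintro ⟨h, w, rfl, rfl⟩
    exact IsChild.mk h w

theorem isChild_mk_succ_iff {h : ℕ} {v : AdelicLevel S (h + 1)} {u : AdelicVertex S} :
    IsChild u (.mk (h + 1) v) ↔ u = .mk h v.parent := by
  rw [isChild_iff]
  constructor
  · rintro ⟨k, w, rfl, hw⟩
    obtain rfl : h = k := by have := AdelicVertex.eq_of_mk_eq_mk hw; omega
    rw [AdelicVertex.mk_injective _ hw]
  · rintro rfl
    exact ⟨h, v, rfl, rfl⟩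

theorem isChild_mk_iff {h : ℕ} {v : AdelicLevel S h} {u : AdelicVertex S} :
    IsChild (.mk h v) u ↔ ∃ w : AdelicLevel S (h + 1), w.parent = v ∧ .mk (h + 1) w = u := by
  rw [isChild_iff]
  constructor
  · rintro ⟨k, w, hw, rfl⟩
    obtain rfl : h = k := AdelicVertex.eq_of_mk_eq_mk hw
    exact ⟨w, (AdelicVertex.mk_injective _ hw).symm, rfl⟩
  · rintro ⟨w, rfl, rfl⟩
    exact ⟨h, w, rfl, rfl⟩

theorem not_isChild_mk_zero {v : AdelicLevel S 0} {u : AdelicVertex S} :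
    ¬ IsChild u (.mk 0 v) := by
  rw [isChild_iff]
  rintro ⟨k, w, -, hw⟩
  have := AdelicVertex.eq_of_mk_eq_mk hw
  omega

/-! ### Averages over the neighbours of a vertex -/

theorem lintegral_uniformOn {V : Type*} [MeasurableSpace V] [DiscreteMeasurableSpace V]
    (t : Finset V) (g : V → ℝ≥0) :
    ∫⁻ w, g w ∂uniformOn (t : Set V) = ((t.card : ℝ≥0∞))⁻¹ * ∑ w ∈ t, (g w : ℝ≥0∞) := by
  rw [uniformOn, ProbabilityTheory.cond, lintegral_smul_measure, lintegral_finset,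
    Measure.count_apply_finset]
  simp

variable [IsNoetherianRing R] [Finite (IsLocalRing.ResidueField R)]

open Classical in
theorem lintegral_walkKernel_succ (F : AdelicVertex S → ℝ≥0) {h : ℕ} (v : AdelicLevel S (h + 1)) :
    ∫⁻ w, F w ∂walkKernel (adelicTree S) (.mk (h + 1) v) =
      (((F (.mk h v.parent) + ∑ u : AdelicLevel S (h + 2) with u.parent = v, F (.mk (h + 2) u)) /
        (1 + (Finset.univ.filter fun u : AdelicLevel S (h + 2) => u.parent = v).card) : ℝ≥0) :
          ℝ≥0∞) := by
  let i : AdelicLevel S (h + 2) ↪ AdelicVertex S := ⟨.mk (h + 2), AdelicVertex.mk_injective _⟩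
  let c := (Finset.univ.filter fun u : AdelicLevel S (h + 2) => u.parent = v).map i
  have hc : AdelicVertex.mk h v.parent ∉ c := by
    intro hmem
    obtain ⟨u, -, hu⟩ := Finset.mem_map.1 hmem
    have := AdelicVertex.eq_of_mk_eq_mk hu
    omega
  have hn : (adelicTree S).neighborSet (.mk (h + 1) v) =
      ↑(insert (AdelicVertex.mk h v.parent) c) := by
    ext w
    change IsChild _ _ ∨ IsChild _ _ ↔ _
    rw [isChild_mk_succ_iff, isChild_mk_iff]
    simp [c, i, or_comm]
  change ∫⁻ w, F w ∂uniformOn _ = _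
  rw [hn, lintegral_uniformOn, Finset.card_insert_of_notMem hc, Finset.sum_insert hc,
    Finset.card_map, Finset.sum_map, ENNReal.coe_div (by positivity), div_eq_mul_inv, mul_comm]
  congr 2
  · push_cast
    rfl
  · push_cast
    ring

theorem lintegral_walkKernel_zero (F : AdelicVertex S → ℝ≥0) (v : AdelicLevel S 0) :
    ∫⁻ w, F w ∂walkKernel (adelicTree S) (.mk 0 v) =
      (((∑ u : AdelicLevel S 1, F (.mk 1 u)) / Fintype.card (AdelicLevel S 1) : ℝ≥0) : ℝ≥0∞) := by
  let i : AdelicLevel S 1 ↪ AdelicVertex S := ⟨.mk 1, AdelicVertex.mk_injective _⟩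
  have hn : (adelicTree S).neighborSet (.mk 0 v) = ↑(Finset.univ.map i) := by
    ext w
    change IsChild _ _ ∨ IsChild _ _ ↔ _
    rw [isChild_mk_iff, or_iff_left not_isChild_mk_zero]
    simp [i, Subsingleton.elim _ v]
  obtain ⟨s, -⟩ := AdelicLevel.of_surjective 0 v
  have : Nonempty (AdelicLevel S 1) := ⟨AdelicLevel.of S 1 s⟩
  change ∫⁻ w, F w ∂uniformOn _ = _
  rw [hn, lintegral_uniformOn, Finset.card_map, Finset.sum_map,
    ENNReal.coe_div (Nat.cast_ne_zero.2 Fintype.card_ne_zero), div_eq_mul_inv, mul_comm]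
  congr 1
  · push_cast
    rfl

/-! ### Transience and flows -/

theorem sum_fiberwise_parent {M : Type*} [AddCommMonoid M] {h : ℕ} [DecidableEq (AdelicLevel S h)]
    (F : AdelicLevel S (h + 1) → M) :
    ∑ v, ∑ u : AdelicLevel S (h + 1) with u.parent = v, F u = ∑ u, F u :=
  Finset.sum_fiberwise _ _ _

/-- The hitting probability of the root decreases away from the root. -/
theorem hitProb_le_parent (r : AdelicVertex S) (hr : r.1 = 0) {h : ℕ} (v : AdelicLevel S (h + 1)) :
    hitProb (adelicTree S) r (.mk (h + 1) v) ≤ hitProb (adelicTree S) r (.mk h v.parent) := by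
  classical
  set f := hitProb (adelicTree S) r
  -- Cutting the hitting probability off at its value at the parent, on the descendants `D` of `v`
  -- only, keeps it superharmonic off `r`. Minimality of the hitting probability then bounds it by
  -- the cut-off function.
  set D : AdelicVertex S → Prop := Relation.ReflTransGen IsChild (.mk (h + 1) v) with hD
  set W : AdelicVertex S → ℝ≥0∞ := fun u => if D u then min (f u) (f (.mk h v.parent)) else f u with hW
  have key : ∀ u w : AdelicVertex S, IsChild u w → w.1 = u.1 + 1 := by
    intro u w huw
    obtain ⟨k, x, rfl, rfl⟩ := isChild_iff.1 huw
    rfl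
  have hlev : ∀ u, D u → h + 1 ≤ u.1 := by
    intro u hu
    induction hu with
    | refl => exact le_rfl
    | tail _ hc ih => rw [key _ _ hc]; omega
  have hWf : ∀ u, W u ≤ f u := fun u => by
    simp only [hW]
    split_ifs
    · exact min_le_left _ _
    · exact le_rfl
  have h1 : f (.mk (h + 1) v) ≤ W (.mk (h + 1) v) := by
    refine hitProb_le_of_superharmonic _ ?_ (fun u hu => ?_) _
    · have : ¬ D r := fun hDr => by have := hlev r hDr; omega
      simp [hW, this, f]
    · have h2 : ∫⁻ w, W w ∂walkKernel (adelicTree S) u ≤ f u :=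
        (lintegral_mono hWf).trans (hitProb_of_ne _ hu).ge
      by_cases hDu : D u
      · rw [show W u = min (f u) (f (.mk h v.parent)) by simp [hW, hDu]]
        refine le_min h2 ?_
        have hnb : ∀ w ∈ (adelicTree S).neighborSet u, W w ≤ f (.mk h v.parent) := by
          have aux : ∀ w, D w → W w ≤ f (.mk h v.parent) := fun w hw => by
            rw [show W w = min (f w) (f (.mk h v.parent)) by simp [hW, hw]]
            exact min_le_right _ _
          rintro w (hw | hw)
          · exact aux w (hDu.tail hw)
          -- Only `v` itself has a neighbour outside `D`, and this is its parent, where the bound is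
          -- an equality.
          · obtain heq | ⟨y, hy, hyu⟩ := Relation.ReflTransGen.cases_tail hDu
            · subst heq
              rw [isChild_mk_succ_iff.1 hw]
              exact hWf _
            · obtain ⟨k, x, rfl⟩ := u.exists_eq_mk
              obtain _ | k := k
              · exact absurd hw not_isChild_mk_zero
              · rw [isChild_mk_succ_iff] at hw hyu
                exact aux w (by rwa [hw, ← hyu])
        have hae : ∀ᵐ w ∂walkKernel (adelicTree S) u, W w ≤ f (.mk h v.parent) := by
          have : ∀ᵐ w ∂uniformOn ((adelicTree S).neighborSet u),
              w ∈ (adelicTree S).neighborSet u :=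
            ae_cond_mem MeasurableSet.of_discrete
          exact this.mono hnb
        exact (lintegral_mono_ae hae).trans (by simp)
      · rw [show W u = f u by simp [hW, hDu]]
        exact h2
  rw [show W (.mk (h + 1) v) = min (f (.mk (h + 1) v)) (f (.mk h v.parent)) by
    simp [hW, show D (.mk (h + 1) v) from Relation.ReflTransGen.refl]] at h1
  exact h1.trans (min_le_right _ _)

/-- The hitting probability of the root is harmonic off the root and decreases away from it, so its
drops along the edges form a flow. The flow is nonzero because the walk escapes with positive
probability, and its energy is bounded by summation by parts. -/
theorem exists_isUnitFlow_of_isTransientSubset (hS : S.Nonempty) (ht : IsTransientSubset S hS) :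
    ∃ θ, IsUnitFlow S θ ∧ flowEnergy θ < ∞ := by
  classical
  set r : AdelicVertex S := adelicRoot hS with hr
  set F : AdelicVertex S → ℝ≥0 := fun v => (hitProb (adelicTree S) r v).toNNReal with hF
  have hFc : ∀ v, (F v : ℝ≥0∞) = hitProb (adelicTree S) r v := fun v =>
    ENNReal.coe_toNNReal (ne_top_of_le_ne_top ENNReal.one_ne_top (hitProb_le_one _ _ _))
  have hFr : F r = 1 := by simp [hF]
  have hanti : ∀ (h : ℕ) (v : AdelicLevel S (h + 1)), F (.mk (h + 1) v) ≤ F (.mk h v.parent) :=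
    fun h v => by
      rw [← ENNReal.coe_le_coe, hFc, hFc]
      exact hitProb_le_parent r rfl v
  have hharm : ∀ (h : ℕ) (v : AdelicLevel S (h + 1)),
      F (.mk (h + 1) v) * (1 + (Finset.univ.filter fun u : AdelicLevel S (h + 2) => u.parent = v).card) =
        F (.mk h v.parent) + ∑ u : AdelicLevel S (h + 2) with u.parent = v, F (.mk (h + 2) u) := by
    intro h v
    have hne : AdelicVertex.mk (h + 1) v ≠ r := fun heq => by
      have := AdelicVertex.eq_of_mk_eq_mk heq
      omega
    have h1 := hitProb_of_ne (adelicTree S) hne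
    simp only [← hFc] at h1
    rw [lintegral_walkKernel_succ, ENNReal.coe_inj] at h1
    rw [h1, div_mul_cancel₀ _ (by positivity)]
  let d : (h : ℕ) → AdelicLevel S (h + 1) → ℝ≥0 := fun h v => F (.mk h v.parent) - F (.mk (h + 1) v)
  have hd : ∀ h v, d h v + F (.mk (h + 1) v) = F (.mk h v.parent) := fun h v =>
    tsub_add_cancel_of_le (hanti h v)
  have hcons : ∀ (h : ℕ) (v : AdelicLevel S (h + 1)),
      d h v = ∑ u : AdelicLevel S (h + 2) with u.parent = v, d (h + 1) u := by
    intro h v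
    have h1 : ∑ u : AdelicLevel S (h + 2) with u.parent = v, d (h + 1) u +
        ∑ u : AdelicLevel S (h + 2) with u.parent = v, F (.mk (h + 2) u) =
        (Finset.univ.filter fun u : AdelicLevel S (h + 2) => u.parent = v).card * F (.mk (h + 1) v) := by
      rw [← Finset.sum_add_distrib, ← nsmul_eq_mul, ← Finset.sum_const]
      refine Finset.sum_congr rfl fun u hu => ?_
      rw [hd, (Finset.mem_filter.1 hu).2]
    have h2 := hharm h v
    rw [← hd] at h2
    rw [mul_add, mul_one, mul_comm _ ((Finset.card _ : ℕ) : ℝ≥0), ← h1] at h2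
    refine add_left_cancel (a := F (.mk (h + 1) v) +
      ∑ u : AdelicLevel S (h + 2) with u.parent = v, F (.mk (h + 2) u)) ?_
    exact (by ring : _ = _).trans (h2.symm.trans (by ring))
  set c : ℝ≥0 := ∑ v, d 0 v with hc
  have hF0 : ∀ v : AdelicLevel S 0, F (.mk 0 v) = 1 := fun v => by
    rw [AdelicVertex.mk_zero_eq_adelicRoot hS, hFr]
  -- A zero total drop would make the return probability equal to one.
  have hcne : c ≠ 0 := by
    intro hc0
    have h1 := lintegral_hitProb_lt_one (adelicTree S) ht
    have hsum : c + ∑ v : AdelicLevel S 1, F (.mk 1 v) = Fintype.card (AdelicLevel S 1) := by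
      rw [hc, ← Finset.sum_add_distrib]
      simp only [hd, hF0]
      simp
    rw [← hr] at h1
    simp only [← hFc] at h1
    have : Nonempty (AdelicLevel S 1) := ⟨AdelicLevel.of S 1 ⟨_, hS.some_mem⟩⟩
    rw [hr, ← AdelicVertex.mk_zero_eq_adelicRoot hS (AdelicLevel.of S 0 ⟨_, hS.some_mem⟩),
      lintegral_walkKernel_zero, ← zero_add (∑ v : AdelicLevel S 1, F (.mk 1 v)), ← hc0, hsum,
      div_self (Nat.cast_ne_zero.2 Fintype.card_ne_zero)] at h1
    simp at h1
  -- Discrete Green identity: the boundary term at level `n` splits over the children into the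
  -- energy of the next level and the next boundary term.
  have henergy : ∀ n, ∑ h ∈ Finset.range (n + 1), ∑ v, d h v ^ 2 +
      ∑ v, d n v * F (.mk (n + 1) v) = c := by
    intro n
    induction n with
    | zero =>
      rw [Finset.sum_range_one, ← Finset.sum_add_distrib, hc]
      refine Finset.sum_congr rfl fun v _ => ?_
      rw [pow_two, ← mul_add, hd, hF0, mul_one]
    | succ n ih =>
      rw [← ih, Finset.sum_range_succ _ (n + 1), add_assoc, ← Finset.sum_add_distrib]
      congr 1
      rw [← sum_fiberwise_parent]
      refine Finset.sum_congr rfl fun v _ => ?_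
      rw [hcons, Finset.sum_mul]
      refine Finset.sum_congr rfl fun u hu => ?_
      rw [pow_two, ← mul_add, hd, (Finset.mem_filter.1 hu).2]
  refine ⟨fun h v => d h v / c, ⟨?_, fun h v => ?_⟩, ?_⟩
  · rw [← Finset.sum_div, ← hc, div_self hcne]
  · rw [hcons, Finset.sum_div]
  · refine lt_of_le_of_lt (ENNReal.tsum_le_of_sum_range_le (c := ((c / c ^ 2 : ℝ≥0) : ℝ≥0∞))
      fun n => ?_) ENNReal.coe_lt_top
    norm_cast
    simp only [div_pow, ← Finset.sum_div]
    gcongr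
    rw [← henergy n, Finset.sum_range_succ, add_assoc]
    exact le_self_add

/-- The flow along the path from the root to the class of `s` in `V_h`. -/
noncomputable def pathFlow (θ : (h : ℕ) → AdelicLevel S (h + 1) → ℝ≥0) (s : S) (h : ℕ) : ℝ≥0 :=
  ∑ k ∈ Finset.range h, θ k (AdelicLevel.of S (k + 1) s)

theorem pathFlow_congr (θ : (h : ℕ) → AdelicLevel S (h + 1) → ℝ≥0) {s t : S} {h : ℕ}
    (hst : AdelicLevel.of S h s = AdelicLevel.of S h t) : pathFlow θ s h = pathFlow θ t h := by
  refine Finset.sum_congr rfl fun k hk => ?_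
  rw [AdelicLevel.of_eq_of_le (Finset.mem_range.1 hk) hst]

theorem pathFlow_succ (θ : (h : ℕ) → AdelicLevel S (h + 1) → ℝ≥0) (s : S) (h : ℕ) :
    pathFlow θ s (h + 1) = pathFlow θ s h + θ h (AdelicLevel.of S (h + 1) s) :=
  Finset.sum_range_succ _ _

/-- A unit flow whose voltage is bounded forces the walk to be transient. -/
theorem IsUnitFlow.isTransientSubset {θ : (h : ℕ) → AdelicLevel S (h + 1) → ℝ≥0}
    (hθ : IsUnitFlow S θ) {E : ℝ≥0} (hE : ∀ s h, pathFlow θ s h ≤ E) (hS : S.Nonempty) :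
    IsTransientSubset S hS := by
  classical
  choose rep hrep using fun h => AdelicLevel.of_surjective (S := S) h
  -- The voltage. Conservation of the flow makes it harmonic off the root, and the unit of flow
  -- leaving the root makes it exceed its average there by one over the degree.
  let G : AdelicVertex S → ℝ≥0 := fun v => E - pathFlow θ (rep v.1 v.2) v.1
  have hG : ∀ (h : ℕ) (s : S), G (.mk h (.of S h s)) + pathFlow θ s h = E := fun h s => by
    have h1 : G (.mk h (.of S h s)) = E - pathFlow θ s h :=
      congrArg (E - ·) (pathFlow_congr θ (hrep _ _))
    rw [h1, tsub_add_cancel_of_le (hE s h)]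
  have hGp : ∀ (h : ℕ) (u : AdelicLevel S (h + 1)),
      G (.mk (h + 1) u) + θ h u = G (.mk h u.parent) := by
    intro h u
    obtain ⟨s, rfl⟩ := AdelicLevel.of_surjective _ u
    refine add_right_cancel (b := pathFlow θ s h) ?_
    rw [AdelicLevel.parent_of, hG, add_assoc, add_comm (θ h _), ← pathFlow_succ, hG]
  have hch : ∀ (h : ℕ) (v : AdelicLevel S (h + 1)),
      G (.mk h v.parent) + ∑ u : AdelicLevel S (h + 2) with u.parent = v, G (.mk (h + 2) u) =
        G (.mk (h + 1) v) *
          (1 + (Finset.univ.filter fun u : AdelicLevel S (h + 2) => u.parent = v).card) := by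
    intro h v
    have h1 : ∑ u : AdelicLevel S (h + 2) with u.parent = v, G (.mk (h + 2) u) + θ h v =
        (Finset.univ.filter fun u : AdelicLevel S (h + 2) => u.parent = v).card *
          G (.mk (h + 1) v) := by
      rw [hθ.conserved, ← Finset.sum_add_distrib, ← nsmul_eq_mul, ← Finset.sum_const]
      refine Finset.sum_congr rfl fun u hu => ?_
      rw [hGp, (Finset.mem_filter.1 hu).2]
    rw [← hGp, mul_add, mul_one, mul_comm _ ((Finset.card _ : ℕ) : ℝ≥0), ← h1]
    ring
  have : Nonempty (AdelicLevel S 1) := ⟨AdelicLevel.of S 1 ⟨_, hS.some_mem⟩⟩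
  have hcard : (Fintype.card (AdelicLevel S 1) : ℝ≥0) ≠ 0 :=
    Nat.cast_ne_zero.2 Fintype.card_ne_zero
  have hroot : ∫⁻ w, G w ∂walkKernel (adelicTree S) (adelicRoot hS) +
      ((1 / Fintype.card (AdelicLevel S 1) : ℝ≥0) : ℝ≥0∞) ≤ G (adelicRoot hS) := by
    let s₀ : S := ⟨_, hS.some_mem⟩
    rw [← AdelicVertex.mk_zero_eq_adelicRoot hS (.of S 0 s₀), lintegral_walkKernel_zero]
    rw [← ENNReal.coe_add, ENNReal.coe_le_coe]
    have h1 : ∑ u : AdelicLevel S 1, G (.mk 1 u) + 1 =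
        Fintype.card (AdelicLevel S 1) * G (.mk 0 (.of S 0 s₀)) := by
      rw [← hθ.total, ← Finset.sum_add_distrib]
      simp only [hGp, Subsingleton.elim (AdelicLevel.parent _) (AdelicLevel.of S 0 s₀)]
      simp
    rw [← add_div, h1, mul_div_cancel_left₀ _ hcard]
  refine walkIsTransient_of_superharmonic (adelicTree S) (g := fun v => (G v : ℝ≥0∞))
    (c := ((1 / Fintype.card (AdelicLevel S 1) : ℝ≥0) : ℝ≥0∞)) ?_ ENNReal.coe_ne_top
    (fun v => ?_) hroot
  · simpa using hcard
  · obtain ⟨h, v, rfl⟩ := v.exists_eq_mk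
    obtain _ | h := h
    · rw [AdelicVertex.mk_zero_eq_adelicRoot hS]
      exact le_self_add.trans hroot
    · rw [lintegral_walkKernel_succ, hch, mul_div_cancel_right₀ _ (by positivity)]

end AdelicTreeWalk

/-! ### The unit current flow -/

section UnitCurrentFlow

set_option linter.unusedSectionVars false

variable {R : Type*} [CommRing R] [IsLocalRing R] [IsNoetherianRing R]
  [Finite (IsLocalRing.ResidueField R)] {S : Set R}
  {θ η σ : (h : ℕ) → AdelicLevel S (h + 1) → ℝ≥0}

theorem flowEnergy_eq_tsum_coe (θ : (h : ℕ) → AdelicLevel S (h + 1) → ℝ≥0) :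
    flowEnergy θ = ∑' h, ((∑ v, θ h v ^ 2 : ℝ≥0) : ℝ≥0∞) := by
  unfold flowEnergy
  push_cast
  rfl

theorem flowEnergy_lt_top_iff_summable :
    flowEnergy θ < ∞ ↔ Summable fun h => ∑ v, (θ h v : ℝ) ^ 2 := by
  rw [flowEnergy_eq_tsum_coe, lt_top_iff_ne_top, ENNReal.tsum_coe_ne_top_iff_summable,
    ← NNReal.summable_coe]
  push_cast
  rfl

theorem flowEnergy_eq_ofReal (hθ : flowEnergy θ < ∞) :
    flowEnergy θ = ENNReal.ofReal (∑' h, ∑ v, (θ h v : ℝ) ^ 2) := by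
  have h1 := flowEnergy_lt_top_iff_summable.1 hθ
  rw [ENNReal.ofReal_tsum_of_nonneg (fun h => by positivity) h1]
  unfold flowEnergy
  refine tsum_congr fun h => ?_
  rw [ENNReal.ofReal_sum_of_nonneg fun v _ => by positivity]
  refine Finset.sum_congr rfl fun v _ => ?_
  rw [ENNReal.ofReal_pow NNReal.zero_le_coe, ENNReal.ofReal_coe_nnreal]

theorem IsUnitFlow.sum_eq_one (hθ : IsUnitFlow S θ) (h : ℕ) : ∑ v, θ h v = 1 := by
  classical
  induction h with
  | zero => exact hθ.total
  | succ h ih =>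
    rw [← ih, ← sum_fiberwise_parent]
    refine Finset.sum_congr rfl fun v _ => ?_
    rw [hθ.conserved]

theorem IsUnitFlow.le_one (hθ : IsUnitFlow S θ) (h : ℕ) (v : AdelicLevel S (h + 1)) :
    θ h v ≤ 1 := by
  rw [← hθ.sum_eq_one h]
  exact Finset.single_le_sum (fun _ _ => zero_le) (Finset.mem_univ v)

theorem isClosed_setOf_isUnitFlow : IsClosed {θ | IsUnitFlow S θ} := by
  classical
  have heq : {θ | IsUnitFlow S θ} = {θ | ∑ v, θ 0 v = 1} ∩
      ⋂ (h : ℕ) (v : AdelicLevel S (h + 1)),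
        {θ | θ h v = ∑ u : AdelicLevel S (h + 2) with u.parent = v, θ (h + 1) u} := by
    ext θ
    simp only [Set.mem_ofPred_eq, Set.mem_inter_iff, Set.mem_iInter]
    exact ⟨fun hθ => ⟨hθ.total, fun h v => hθ.conserved h v⟩,
      fun hθ => ⟨hθ.1, fun h v => hθ.2 h v⟩⟩
  rw [heq]
  refine IsClosed.inter (isClosed_eq (by fun_prop) continuous_const) ?_
  exact isClosed_iInter fun h => isClosed_iInter fun v => isClosed_eq (by fun_prop) (by fun_prop)

theorem isCompact_setOf_isUnitFlow : IsCompact {θ | IsUnitFlow S θ} := by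
  refine IsCompact.of_isClosed_subset (isCompact_univ_pi (s := fun h : ℕ =>
    Set.univ.pi fun _ : AdelicLevel S (h + 1) => Set.Icc (0 : ℝ≥0) 1)
      fun h => isCompact_univ_pi fun v => isCompact_Icc) isClosed_setOf_isUnitFlow ?_
  intro θ hθ h _ v _
  exact ⟨zero_le, hθ.le_one h v⟩

theorem lowerSemicontinuous_flowEnergy :
    LowerSemicontinuous (flowEnergy : ((h : ℕ) → AdelicLevel S (h + 1) → ℝ≥0) → ℝ≥0∞) := by
  refine lowerSemicontinuous_tsum fun h => Continuous.lowerSemicontinuous ?_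
  refine continuous_finsetSum _ fun v _ => ?_
  exact (ENNReal.continuous_pow 2).comp (ENNReal.continuous_coe.comp (by fun_prop))

/-- The direct method: unit flows form a compact set for pointwise convergence, and the energy is
lower semicontinuous. -/
theorem exists_isUnitCurrentFlow (hθ : IsUnitFlow S θ) (he : flowEnergy θ < ∞) :
    ∃ η, IsUnitCurrentFlow S η := by
  obtain ⟨η, hη, hmin⟩ := LowerSemicontinuousOn.exists_isMinOn (s := {θ | IsUnitFlow S θ})
    ⟨θ, hθ⟩ isCompact_setOf_isUnitFlow (lowerSemicontinuous_flowEnergy.lowerSemicontinuousOn _)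
  exact ⟨η, hη, (hmin hθ).trans_lt he, fun ξ hξ => hmin hξ⟩

theorem IsUnitCurrentFlow.tsum_le (hη : IsUnitCurrentFlow S η) (hθ : IsUnitFlow S θ)
    (hs : Summable fun h => ∑ v, (θ h v : ℝ) ^ 2) :
    ∑' h, ∑ v, (η h v : ℝ) ^ 2 ≤ ∑' h, ∑ v, (θ h v : ℝ) ^ 2 := by
  have h1 := hη.minimal θ hθ
  rw [flowEnergy_eq_ofReal hη.bounded,
    flowEnergy_eq_ofReal (flowEnergy_lt_top_iff_summable.2 hs)] at h1
  exact (ENNReal.ofReal_le_ofReal_iff (tsum_nonneg fun h => by positivity)).1 h1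

/-- The unit current flow is unique. -/
theorem IsUnitCurrentFlow.unique (hη : IsUnitCurrentFlow S η) (hθ : IsUnitCurrentFlow S θ) :
    θ = η := by
  classical
  have sη := flowEnergy_lt_top_iff_summable.1 hη.bounded
  have sθ := flowEnergy_lt_top_iff_summable.1 hθ.bounded
  -- The midpoint of two minimizers. By the parallelogram law its energy is smaller than theirs by
  -- the energy `D` of half the difference, so `D` vanishes.
  let ξ : (h : ℕ) → AdelicLevel S (h + 1) → ℝ≥0 := fun h v => (η h v + θ h v) / 2
  have hξ : IsUnitFlow S ξ := by
    refine ⟨?_, fun h v => ?_⟩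
    · simp only [ξ]
      rw [← Finset.sum_div, Finset.sum_add_distrib, hη.unitFlow.total, hθ.unitFlow.total]
      norm_num
    · simp only [ξ]
      rw [← Finset.sum_div, Finset.sum_add_distrib, hη.unitFlow.conserved, hθ.unitFlow.conserved]
  let D : ℕ → ℝ := fun h => ∑ v, (((η h v : ℝ) - θ h v) / 2) ^ 2
  have hid : ∀ h, ∑ v, (ξ h v : ℝ) ^ 2 =
      ((∑ v, (η h v : ℝ) ^ 2) + ∑ v, (θ h v : ℝ) ^ 2) / 2 - D h := fun h => by
    rw [← Finset.sum_add_distrib, Finset.sum_div, ← Finset.sum_sub_distrib]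
    refine Finset.sum_congr rfl fun v _ => ?_
    simp only [ξ]
    push_cast
    ring
  have hD0 : ∀ h, 0 ≤ D h := fun h => by positivity
  have hD : Summable D := by
    refine Summable.of_nonneg_of_le hD0 (fun h => ?_) ((sη.add sθ).div_const 2)
    linarith [hid h, show 0 ≤ ∑ v, (ξ h v : ℝ) ^ 2 by positivity]
  have hs : Summable fun h => ∑ v, (ξ h v : ℝ) ^ 2 := by
    simp only [hid]
    exact ((sη.add sθ).div_const 2).sub hD
  have h1 := hη.tsum_le hξ hs
  have h2 := hη.tsum_le hθ.unitFlow sθ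
  have h3 := hθ.tsum_le hη.unitFlow sη
  simp only [hid] at h1
  rw [((sη.add sθ).div_const 2).tsum_sub hD, tsum_div_const, sη.tsum_add sθ] at h1
  have h4 : ∑' h, D h = 0 := le_antisymm (by linarith) (tsum_nonneg hD0)
  funext h v
  have h5 : D h = 0 := le_antisymm ((hD.le_tsum h fun _ _ => hD0 _).trans h4.le) (hD0 h)
  have h6 := (Finset.sum_eq_zero_iff_of_nonneg fun v _ => by positivity).1 h5 v (Finset.mem_univ v)
  rw [sq_eq_zero_iff] at h6
  exact NNReal.coe_injective (by linarith)

/-! ### First variation and the bound on the voltage -/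

/-- The unit current flow has its energy as inner product with any unit flow dominated by a
multiple of it. -/
theorem IsUnitCurrentFlow.sum_mul_le (hη : IsUnitCurrentFlow S η) (hσ : IsUnitFlow S σ) {p : ℝ≥0}
    (hp : p ≠ 0) (hle : ∀ h v, p * σ h v ≤ η h v) (n : ℕ) :
    ∑ h ∈ Finset.range n, ∑ v, (η h v : ℝ) * σ h v ≤ ∑' h, ∑ v, (η h v : ℝ) ^ 2 := by
  classical
  have hp0 : (0 : ℝ) < p := NNReal.coe_pos.2 (pos_iff_ne_zero.2 hp)
  have hle' : ∀ h v, (σ h v : ℝ) ≤ η h v / p := fun h v => by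
    rw [le_div_iff₀ hp0, mul_comm]
    exact_mod_cast hle h v
  have sA := flowEnergy_lt_top_iff_summable.1 hη.bounded
  set A : ℕ → ℝ := fun h => ∑ v, (η h v : ℝ) ^ 2 with hA
  let B : ℕ → ℝ := fun h => ∑ v, (η h v : ℝ) * σ h v
  let C : ℕ → ℝ := fun h => ∑ v, ((η h v : ℝ) - σ h v) ^ 2
  have hB0 : ∀ h, 0 ≤ B h := fun h => by positivity
  have sB : Summable B := by
    refine Summable.of_nonneg_of_le hB0 (fun h => ?_) (sA.div_const p)
    rw [hA, Finset.sum_div]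
    refine Finset.sum_le_sum fun v _ => ?_
    rw [pow_two, mul_div_assoc]
    exact mul_le_mul_of_nonneg_left (hle' h v) NNReal.zero_le_coe
  have hC0 : ∀ h, 0 ≤ C h := fun h => by positivity
  have sC : Summable C := by
    refine Summable.of_nonneg_of_le hC0 (fun h => ?_) (sA.mul_right (1 + 1 / (p : ℝ) ^ 2))
    rw [hA, Finset.sum_mul]
    refine Finset.sum_le_sum fun v _ => ?_
    have h1 : (σ h v : ℝ) ^ 2 ≤ (η h v / p) ^ 2 := pow_le_pow_left₀ NNReal.zero_le_coe (hle' h v) 2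
    have h2 : (0 : ℝ) ≤ η h v * σ h v := by positivity
    rw [div_pow] at h1
    rw [mul_add, mul_one, mul_one_div]
    nlinarith
  refine (sB.sum_le_tsum _ fun h _ => hB0 h).trans ?_
  have key : ∀ t : ℝ≥0, t ≠ 0 → t ≤ p →
      ∑' h, B h ≤ ∑' h, A h + t / 2 * ∑' h, C h := by
    intro t ht htp
    have ht0 : (0 : ℝ) < t := NNReal.coe_pos.2 (pos_iff_ne_zero.2 ht)
    -- A step from `η` away from `σ`; `t ≤ p` and `p σ ≤ η` keep it nonnegative. Its energy is `A +
    -- 2 t (A - B) + t² C`, summed over the levels. Minimality and division by `t` give the bound.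
    let ξ : (h : ℕ) → AdelicLevel S (h + 1) → ℝ≥0 := fun h v => (1 + t) * η h v - t * σ h v
    have hξa : ∀ h v, ξ h v + t * σ h v = (1 + t) * η h v := fun h v =>
      tsub_add_cancel_of_le (((mul_le_mul_left htp _).trans (hle h v)).trans
        (le_mul_of_one_le_left zero_le le_self_add))
    have hξ : IsUnitFlow S ξ := by
      refine ⟨add_right_cancel (b := t) ?_, fun h v => add_right_cancel (b := t * σ h v) ?_⟩
      · calc ∑ v, ξ 0 v + t = ∑ v, (ξ 0 v + t * σ 0 v) := by
              rw [Finset.sum_add_distrib, ← Finset.mul_sum, hσ.total, mul_one]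
          _ = 1 + t := by simp only [hξa]; rw [← Finset.mul_sum, hη.unitFlow.total, mul_one]
      · rw [hξa, hσ.conserved, hη.unitFlow.conserved, Finset.mul_sum, Finset.mul_sum,
          ← Finset.sum_add_distrib]
        exact Finset.sum_congr rfl fun u _ => (hξa _ _).symm
    have hid : ∀ h, ∑ v, (ξ h v : ℝ) ^ 2 = A h + 2 * t * (A h - B h) + t ^ 2 * C h := fun h => by
      simp only [hA, B, C]
      rw [← Finset.sum_sub_distrib, Finset.mul_sum, Finset.mul_sum, ← Finset.sum_add_distrib,
        ← Finset.sum_add_distrib]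
      refine Finset.sum_congr rfl fun v _ => ?_
      have h1 : (ξ h v : ℝ) = (1 + t) * η h v - t * σ h v :=
        eq_sub_of_add_eq (by exact_mod_cast hξa h v)
      rw [h1]
      ring
    have s1 := (sA.sub sB).mul_left (2 * (t : ℝ))
    have s2 := sC.mul_left ((t : ℝ) ^ 2)
    have h1 := hη.tsum_le hξ (by simp only [hid]; exact (sA.add s1).add s2)
    simp only [hid] at h1
    rw [(sA.add s1).tsum_add s2, sA.tsum_add s1, tsum_mul_left, tsum_mul_left,
      sA.tsum_sub sB] at h1
    have h2 : 0 ≤ t * (2 * (∑' h, A h - ∑' h, B h) + t * ∑' h, C h) := by linarith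
    have h3 := nonneg_of_mul_nonneg_right h2 ht0
    linarith
  by_contra hcon
  push Not at hcon
  set d := ∑' h, B h - ∑' h, A h with hd
  have hd0 : 0 < d := by linarith
  have hCs : 0 ≤ ∑' h, C h := tsum_nonneg hC0
  -- This value of `t` is admissible in `key` and satisfies `t C < d`, against the bound `d ≤ t C /
  -- 2`. The added `1` avoids division by zero.
  have hq : 0 < min (p : ℝ) (d / (∑' h, C h + 1)) := lt_min hp0 (by positivity)
  have h1 := key ⟨_, hq.le⟩ (fun h0 => hq.ne' (congrArg NNReal.toReal h0))
    (NNReal.coe_le_coe.1 (min_le_left _ _))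
  change _ ≤ _ + min (p : ℝ) (d / (∑' h, C h + 1)) / 2 * _ at h1
  have h2 : min (p : ℝ) (d / (∑' h, C h + 1)) * (∑' h, C h + 1) ≤ d := by
    rw [← le_div_iff₀ (by linarith)]
    exact min_le_right _ _
  nlinarith

open Classical in
/-- The part of a flow that passes through the class of `s` in `V_{n+1}`. -/
noncomputable def restrictFlow (η : (h : ℕ) → AdelicLevel S (h + 1) → ℝ≥0) (s : S) (n h : ℕ)
    (w : AdelicLevel S (h + 1)) : ℝ≥0 :=
  if h < n then if w = .of S (h + 1) s then η n (.of S (n + 1) s) else 0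
  else if ∃ t, w = .of S (h + 1) t ∧ AdelicLevel.of S (n + 1) t = .of S (n + 1) s then η h w else 0

/-- The two clauses of the definition agree at `h = n`, so each description extends to that level.
Conservation across level `n` rests on this overlap. -/
theorem restrictFlow_of_le (η : (h : ℕ) → AdelicLevel S (h + 1) → ℝ≥0) (s : S) {n h : ℕ}
    (hn : h ≤ n) (w : AdelicLevel S (h + 1)) [Decidable (w = .of S (h + 1) s)] :
    restrictFlow η s n h w = if w = .of S (h + 1) s then η n (.of S (n + 1) s) else 0 := by
  classical
  obtain hn | rfl := hn.lt_or_eq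
  · rw [restrictFlow, if_pos hn]
    congr!
  · rw [restrictFlow, if_neg (lt_irrefl _)]
    by_cases hw : w = .of S (h + 1) s
    · rw [if_pos hw, if_pos ⟨s, hw, rfl⟩, hw]
    · rw [if_neg hw, if_neg]
      rintro ⟨t, rfl, ht⟩
      exact hw ht

theorem restrictFlow_of_ge (η : (h : ℕ) → AdelicLevel S (h + 1) → ℝ≥0) (s : S) {n h : ℕ}
    (hn : n ≤ h) (t : S) [Decidable (AdelicLevel.of S (n + 1) t = .of S (n + 1) s)] :
    restrictFlow η s n h (.of S (h + 1) t) =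
      if AdelicLevel.of S (n + 1) t = .of S (n + 1) s then η h (.of S (h + 1) t) else 0 := by
  classical
  rw [restrictFlow, if_neg (not_lt.2 hn)]
  refine if_congr ⟨?_, fun h1 => ⟨t, rfl, h1⟩⟩ rfl rfl
  rintro ⟨t', h1, h2⟩
  rw [← h2]
  exact AdelicLevel.of_eq_of_le (by omega) h1

theorem IsUnitFlow.antitone (hη : IsUnitFlow S η) (s : S) :
    Antitone fun h => η h (.of S (h + 1) s) := by
  classical
  refine antitone_nat_of_succ_le fun h => ?_
  rw [hη.conserved h]
  exact Finset.single_le_sum (f := η (h + 1)) (fun _ _ => zero_le)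
    (Finset.mem_filter.2 ⟨Finset.mem_univ _, rfl⟩)

theorem restrictFlow_le (hη : IsUnitFlow S η) (s : S) {n : ℕ} (h : ℕ) (w : AdelicLevel S (h + 1)) :
    restrictFlow η s n h w ≤ η h w := by
  classical
  obtain hn | hn := le_total h n
  · rw [restrictFlow_of_le _ _ hn]
    split_ifs with hw
    · rw [hw]
      exact hη.antitone s hn
    · exact zero_le
  · obtain ⟨t, rfl⟩ := AdelicLevel.of_surjective _ w
    rw [restrictFlow_of_ge _ _ hn]
    split_ifs
    · exact le_rfl
    · exact zero_le

/-- Above level `n` the restriction follows the single path to the class of `s`. From level `n` on,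
either all children of a vertex lie below that class or none do. -/
theorem restrictFlow_conserved (hη : IsUnitFlow S η) (s : S) (n h : ℕ)
    (v : AdelicLevel S (h + 1)) [DecidableEq (AdelicLevel S (h + 1))] :
    restrictFlow η s n h v =
      ∑ u : AdelicLevel S (h + 2) with u.parent = v, restrictFlow η s n (h + 1) u := by
  classical
  obtain hn | hn := lt_or_ge h n
  · rw [restrictFlow_of_le _ _ hn.le]
    simp only [restrictFlow_of_le _ _ (show h + 1 ≤ n from hn)]
    rw [Finset.sum_ite_eq']
    simp only [Finset.mem_filter, Finset.mem_univ, true_and, AdelicLevel.parent_of]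
    exact if_congr eq_comm rfl rfl
  · obtain ⟨t, rfl⟩ := AdelicLevel.of_surjective _ v
    have h1 : ∀ u ∈ Finset.univ.filter fun u : AdelicLevel S (h + 2) => u.parent = .of S (h + 1) t,
        restrictFlow η s n (h + 1) u =
          if AdelicLevel.of S (n + 1) t = .of S (n + 1) s then η (h + 1) u else 0 := by
      intro u hu
      obtain ⟨t', rfl⟩ := AdelicLevel.of_surjective _ u
      have h2 : AdelicLevel.of S (h + 1) t' = .of S (h + 1) t := (Finset.mem_filter.1 hu).2
      rw [restrictFlow_of_ge _ _ (by omega), AdelicLevel.of_eq_of_le (by omega) h2]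
    rw [restrictFlow_of_ge _ _ hn, hη.conserved]
    refine Eq.trans ?_ (Finset.sum_congr ?_ h1).symm
    · split_ifs
      · congr!
      · simp
    · congr!

/-- The voltage of the unit current flow is nonnegative. -/
theorem IsUnitCurrentFlow.pathFlow_le (hη : IsUnitCurrentFlow S η) (s : S) (h : ℕ) :
    (pathFlow η s h : ℝ) ≤ ∑' h, ∑ v, (η h v : ℝ) ^ 2 := by
  classical
  induction h with
  | zero =>
    simp only [pathFlow, Finset.range_zero, Finset.sum_empty, NNReal.coe_zero]
    exact tsum_nonneg fun h => by positivity
  | succ n ih =>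
    set p := η n (.of S (n + 1) s) with hpdef
    obtain hp | hp := eq_or_ne p 0
    · rwa [pathFlow_succ, ← hpdef, hp, add_zero]
    -- The normalized part of `η` through the class of `s` puts mass one on each edge of the path up
    -- to level `n`, so its inner product with `η` over these levels is the path sum.
    · let σ : (h : ℕ) → AdelicLevel S (h + 1) → ℝ≥0 := fun h v => restrictFlow η s n h v / p
      have hσ : IsUnitFlow S σ := by
        refine ⟨?_, fun h v => ?_⟩
        · simp only [σ, restrictFlow_of_le η s (Nat.zero_le n)]
          rw [← Finset.sum_div, Finset.sum_ite_eq', if_pos (Finset.mem_univ _), div_self hp]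
        · simp only [σ]
          rw [← Finset.sum_div, ← restrictFlow_conserved hη.unitFlow]
      refine le_trans (le_of_eq ?_) (hη.sum_mul_le hσ hp (fun h v => ?_) (n + 1))
      · rw [pathFlow]
        push_cast
        refine Finset.sum_congr rfl fun h hh => ?_
        have hh' : h ≤ n := Nat.lt_succ_iff.1 (Finset.mem_range.1 hh)
        rw [Finset.sum_eq_single (AdelicLevel.of S (h + 1) s)]
        · simp only [σ, restrictFlow_of_le η s hh', if_true]
          rw [div_self hp, NNReal.coe_one, mul_one]
        · intro v _ hv
          simp only [σ, restrictFlow_of_le η s hh', if_neg hv]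
          simp
        · exact fun h => absurd (Finset.mem_univ _) h
      · simp only [σ]
        rw [mul_div_cancel₀ _ hp]
        exact restrictFlow_le hη.unitFlow s h v

/-- The subset is transient if and only if its tree carries a unit flow of finite energy. -/
theorem isTransientSubset_iff_exists_isUnitFlow (hS : S.Nonempty) :
    IsTransientSubset S hS ↔ ∃ θ, IsUnitFlow S θ ∧ flowEnergy θ < ∞ := by
  refine ⟨exists_isUnitFlow_of_isTransientSubset hS, ?_⟩
  rintro ⟨θ, hθ, he⟩
  obtain ⟨η, hη⟩ := exists_isUnitCurrentFlow hθ he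
  refine hη.unitFlow.isTransientSubset
    (E := ⟨∑' h, ∑ v, (η h v : ℝ) ^ 2, tsum_nonneg fun h => by positivity⟩) (fun s h => ?_) hS
  exact NNReal.coe_le_coe.1 (hη.pathFlow_le s h)

end UnitCurrentFlow

/-! ### Superadditivity of the logarithmic factorials -/

section FactorialGrowth

open IsDiscreteValuationRing Finset

set_option linter.unusedSectionVars false

variable {R : Type*} [CommRing R] [IsDomain R] [IsDiscreteValuationRing R]

/-- A divisor of all values on `S` of a monic polynomial of degree `n` with roots in the ring
divides the `n`-th factorial. -/
theorem IsFactorialDetermining.dvd_of_forall_dvd {S : Set R} {s : ℕ → R}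
    (hs : IsFactorialDetermining S s) {t : ℕ → R} {d : R} {n : ℕ}
    (hdS : ∀ x ∈ S, d ∣ ∏ j ∈ range n, (x - t j)) : d ∣ ∏ j ∈ range n, (s n - s j) := by
  -- Newton expansion in the products `∏ j ∈ range k, (x - s j)`; the polynomial is monic, so the
  -- top coefficient is `1`.
  have expand : ∀ n, ∃ c : ℕ → R, ∀ x, ∏ j ∈ range n, (x - t j) =
      ∑ k ∈ range n, c k * ∏ j ∈ range k, (x - s j) + ∏ j ∈ range n, (x - s j) := by
    intro n
    induction n with
    | zero => exact ⟨0, by simp⟩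
    | succ n ih =>
      obtain ⟨c, hc⟩ := ih
      let c' : ℕ → R := fun k => if k < n then c k else 1
      have hc' : ∀ x, ∏ j ∈ range n, (x - t j) =
          ∑ k ∈ range (n + 1), c' k * ∏ j ∈ range k, (x - s j) := by
        intro x
        rw [hc, sum_range_succ]
        congr 1
        · refine sum_congr rfl fun k hk => ?_
          simp [c', mem_range.1 hk]
        · simp [c']
      refine ⟨fun k => (if k = 0 then 0 else c' (k - 1)) + c' k * (s k - t n), fun x => ?_⟩
      have h1 : ∏ j ∈ range (n + 1), (x - t j) =
          ∑ k ∈ range (n + 1), c' k * ∏ j ∈ range (k + 1), (x - s j) +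
          ∑ k ∈ range (n + 1), c' k * (s k - t n) * ∏ j ∈ range k, (x - s j) := by
        rw [prod_range_succ, hc', sum_mul, ← sum_add_distrib]
        refine sum_congr rfl fun k _ => ?_
        rw [prod_range_succ]
        ring
      rw [h1, sum_range_succ (fun k => c' k * ∏ j ∈ range (k + 1), (x - s j))]
      have h2 : ∑ k ∈ range (n + 1), ((if k = 0 then 0 else c' (k - 1)) + c' k * (s k - t n)) *
          ∏ j ∈ range k, (x - s j) = ∑ k ∈ range n, c' k * ∏ j ∈ range (k + 1), (x - s j) +
          ∑ k ∈ range (n + 1), c' k * (s k - t n) * ∏ j ∈ range k, (x - s j) := by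
        simp only [add_mul, sum_add_distrib]
        congr 1
        rw [sum_range_succ']
        simp
      rw [h2]
      have : c' n = 1 := by simp [c']
      rw [this]
      ring
  obtain ⟨c, hc⟩ := expand n
  have hsS : ∀ k, ∀ x ∈ S, ∏ j ∈ range k, (s k - s j) ∣ ∏ j ∈ range k, (x - s j) :=
    fun k x hx => addVal_le_iff_dvd.1 (hs.minimal k x hx)
  -- Evaluation at `s k` kills the terms of index greater than `k`, so the system is triangular and
  -- each term is divisible by `d` in turn.
  have main : ∀ k, k < n → d ∣ c k * ∏ j ∈ range k, (s k - s j) := by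
    intro k
    induction k using Nat.strong_induction_on with
    | _ k ih =>
      intro hk
      have h := hdS (s k) (hs.mem k)
      rw [hc] at h
      have hz : ∀ m, k < m → ∏ j ∈ range m, (s k - s j) = 0 := fun m hm =>
        prod_eq_zero (mem_range.2 hm) (sub_self _)
      rw [hz n hk, add_zero, ← sum_subset (range_subset_range.2 hk : range (k + 1) ⊆ range n)
        (fun m _ hm => by rw [hz m (by simpa using hm), mul_zero]), sum_range_succ] at h
      refine (dvd_add_right ?_).1 h
      exact dvd_sum fun i hi => (ih i (mem_range.1 hi) ((mem_range.1 hi).trans hk)).trans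
        (mul_dvd_mul_left _ (hsS i _ (hs.mem k)))
  have h := hdS (s n) (hs.mem n)
  rw [hc] at h
  refine (dvd_add_right ?_).1 h
  exact dvd_sum fun i hi => (main i (mem_range.1 hi)).trans
    (mul_dvd_mul_left _ (hsS i _ (hs.mem n)))

theorem coe_toNat_subsetFactorial {S : Set R} (hS : S.Infinite) (n : ℕ) :
    ((subsetFactorial S n).toNat : ℕ∞) = subsetFactorial S n :=
  ENat.natCast_toNat (subsetFactorial_ne_top hS n)

theorem addVal_prod {ι : Type*} (t : Finset ι) (f : ι → R) :
    addVal R (∏ i ∈ t, f i) = ∑ i ∈ t, addVal R (f i) := by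
  classical
  induction t using Finset.induction_on with
  | empty => simp
  | insert i t hi ih => rw [prod_insert hi, sum_insert hi, addVal_mul, ih]

/-- The first `m` terms of a determining sequence followed by its first `n` terms are the roots of a
monic polynomial of degree `m + n`, whose values on `S` are divisible by the product of the two
factorials. -/
theorem subsetFactorial_add_le {S : Set R} (hS : S.Nonempty) (m n : ℕ) :
    subsetFactorial S m + subsetFactorial S n ≤ subsetFactorial S (m + n) := by
  obtain ⟨s, hs⟩ := exists_isFactorialDetermining hS
  rw [subsetFactorial_eq hs, subsetFactorial_eq hs, subsetFactorial_eq hs, ← addVal_mul,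
    addVal_le_iff_dvd]
  refine hs.dvd_of_forall_dvd (t := fun j => if j < m then s j else s (j - m)) fun x hx => ?_
  rw [prod_range_add]
  refine mul_dvd_mul ?_ ?_
  · have h : ∏ j ∈ range m, (x - if j < m then s j else s (j - m)) =
        ∏ j ∈ range m, (x - s j) := prod_congr rfl fun j hj => by rw [if_pos (mem_range.1 hj)]
    rw [h]
    exact addVal_le_iff_dvd.1 (hs.minimal m x hx)
  · have h : ∏ j ∈ range n, (x - if m + j < m then s (m + j) else s (m + j - m)) =
        ∏ j ∈ range n, (x - s j) :=
      prod_congr rfl fun j _ => by rw [if_neg (by omega), Nat.add_sub_cancel_left]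
    rw [h]
    exact addVal_le_iff_dvd.1 (hs.minimal n x hx)

theorem subadditive_neg_subsetFactorial {S : Set R} (hS : S.Infinite) :
    Subadditive fun n => -((subsetFactorial S n).toNat : ℝ) := by
  intro m n
  have h := subsetFactorial_add_le hS.nonempty m n
  rw [← coe_toNat_subsetFactorial hS m, ← coe_toNat_subsetFactorial hS n,
    ← coe_toNat_subsetFactorial hS (m + n)] at h
  have h2 : (subsetFactorial S m).toNat + (subsetFactorial S n).toNat ≤
      (subsetFactorial S (m + n)).toNat := by exact_mod_cast h
  have h3 : ((subsetFactorial S m).toNat : ℝ) + (subsetFactorial S n).toNat ≤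
      (subsetFactorial S (m + n)).toNat := by exact_mod_cast h2
  linarith

theorem subsetFactorial_zero {S : Set R} (hS : S.Nonempty) : subsetFactorial S 0 = 0 := by
  obtain ⟨s, hs⟩ := exists_isFactorialDetermining hS
  rw [subsetFactorial_eq hs]
  simp

/-- If `n!_S / n` is bounded, then it converges to its supremum. -/
theorem exists_tendsto_subsetFactorial_div {S : Set R} (hS : S.Infinite) {E : ℝ}
    (hE : ∀ n : ℕ, ((subsetFactorial S n).toNat : ℝ) ≤ n * E) :
    ∃ L, Tendsto (fun n : ℕ => ((subsetFactorial S n).toNat : ℝ) / n) atTop (𝓝 L) ∧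
      ∀ n : ℕ, ((subsetFactorial S n).toNat : ℝ) ≤ n * L := by
  have hsub := subadditive_neg_subsetFactorial hS
  have hbdd : BddBelow (Set.range fun n : ℕ => -((subsetFactorial S n).toNat : ℝ) / n) := by
    refine ⟨-|E|, ?_⟩
    rintro _ ⟨n, rfl⟩
    obtain rfl | hn := Nat.eq_zero_or_pos n
    · simp
    · have hn' : (0 : ℝ) < n := Nat.cast_pos.2 hn
      simp only
      rw [neg_div, neg_le_neg_iff, div_le_iff₀ hn', mul_comm]
      exact (hE n).trans (mul_le_mul_of_nonneg_left (le_abs_self E) hn'.le)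
  refine ⟨-hsub.lim, ?_, fun n => ?_⟩
  · have := (hsub.tendsto_lim hbdd).neg
    simpa only [neg_div, neg_neg] using this
  · obtain rfl | hn := Nat.eq_zero_or_pos n
    · simp [subsetFactorial_zero hS.nonempty]
    · have hn' : (0 : ℝ) < n := Nat.cast_pos.2 hn
      have := hsub.lim_le_div hbdd hn.ne'
      rw [neg_div, le_neg, div_le_iff₀ hn', mul_comm] at this
      exact this

/-- By superadditivity the limit is also the supremum. -/
theorem subsetFactorial_le_of_tendsto {S : Set R} (hS : S.Infinite) {L : ℝ}
    (hL : Tendsto (fun n : ℕ => ((subsetFactorial S n).toNat : ℝ) / n) atTop (𝓝 L)) (n : ℕ) :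
    ((subsetFactorial S n).toNat : ℝ) ≤ n * L := by
  obtain ⟨E, hE⟩ := hL.bddAbove_range
  obtain ⟨L', h1, h2⟩ := exists_tendsto_subsetFactorial_div hS (E := E) fun n => by
    obtain rfl | hn := Nat.eq_zero_or_pos n
    · simp [subsetFactorial_zero hS.nonempty]
    · rw [mul_comm, ← div_le_iff₀ (Nat.cast_pos.2 hn)]
      exact hE ⟨n, rfl⟩
  rw [tendsto_nhds_unique hL h1]
  exact h2 n

/-! ### Valuations as numbers of agreements -/

theorem coe_le_addVal_iff {x : R} {h : ℕ} :
    (h : ℕ∞) ≤ addVal R x ↔ x ∈ IsLocalRing.maximalIdeal R ^ h := by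
  obtain ⟨ϖ, hϖ⟩ := exists_irreducible R
  rw [hϖ.maximalIdeal_eq, Ideal.span_singleton_pow, Ideal.mem_span_singleton,
    ← addVal_le_iff_dvd, hϖ.addVal_pow]

open Classical in
theorem sum_ite_mem_maximalIdeal_pow (x : R) (n : ℕ) :
    ((∑ h ∈ range n, if x ∈ IsLocalRing.maximalIdeal R ^ (h + 1) then 1 else 0 : ℕ) : ℕ∞) =
      min (n : ℕ∞) (addVal R x) := by
  induction n with
  | zero => simp
  | succ n ih =>
    rw [sum_range_succ, Nat.cast_add, ih]
    split_ifs with hx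
    · rw [← coe_le_addVal_iff] at hx
      rw [min_eq_left hx, min_eq_left (le_trans (by norm_cast; omega) hx)]
      norm_cast
    · rw [← coe_le_addVal_iff, not_le, Nat.cast_add, Nat.cast_one] at hx
      have hx' := Order.le_of_lt_add_one hx
      rw [min_eq_right hx', Nat.cast_zero, add_zero, min_eq_right]
      exact hx'.trans (by norm_cast; omega)

open Classical in
theorem tsum_ite_mem_maximalIdeal_pow (x : R) :
    ∑' h : ℕ, (if x ∈ IsLocalRing.maximalIdeal R ^ (h + 1) then 1 else 0 : ℝ≥0∞) =
      (addVal R x : ℝ≥0∞) := by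
  have h1 : ∀ n : ℕ, 
      ∑ h ∈ range n, (if x ∈ IsLocalRing.maximalIdeal R ^ (h + 1) then 1 else 0 : ℝ≥0∞) =
        ((min (n : ℕ∞) (addVal R x) : ℕ∞) : ℝ≥0∞) := fun n => by
    rw [← sum_ite_mem_maximalIdeal_pow]
    rw [ENat.toENNReal_coe]
    push_cast
    rfl
  rw [ENNReal.tsum_eq_iSup_nat]
  simp only [h1]
  refine le_antisymm (iSup_le fun n => ENat.toENNReal_le.2 (min_le_right _ _)) ?_
  induction addVal R x using ENat.recTopCoe with
  | top =>
    simp only [min_top_right, ENat.toENNReal_coe, ENat.toENNReal_top]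
    exact ENNReal.iSup_natCast.ge
  | coe m =>
    exact le_iSup_of_le m (by simp)

end FactorialGrowth

/-! ### Empirical flows -/

section EmpiricalFlow

open Finset

variable {R : Type*} [CommRing R] [IsLocalRing R] [IsNoetherianRing R]
  [Finite (IsLocalRing.ResidueField R)] {S : Set R}

open Classical in
/-- The proportion of the first `n` terms in each class. -/
noncomputable def empiricalFlow (s : ℕ → S) (n h : ℕ) (v : AdelicLevel S (h + 1)) : ℝ≥0 :=
  (∑ j ∈ range n, if AdelicLevel.of S (h + 1) (s j) = v then 1 else 0) / n

theorem isUnitFlow_empiricalFlow (s : ℕ → S) {n : ℕ} (hn : n ≠ 0) :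
    IsUnitFlow S (empiricalFlow s n) := by
  classical
  refine ⟨?_, fun h v => ?_⟩
  · simp only [empiricalFlow]
    rw [← sum_div, sum_comm]
    simp [hn]
  · simp only [empiricalFlow]
    rw [← sum_div, sum_comm]
    congr 1
    refine sum_congr rfl fun j _ => ?_
    rw [sum_ite_eq]
    simp

end EmpiricalFlow

/-! ### Factorials and the unit current flow -/

section FactorialFlow

open IsDiscreteValuationRing Finset

set_option linter.unusedSectionVars false

variable {R : Type*} [CommRing R] [IsDomain R] [IsDiscreteValuationRing R] {S : Set R} {s : ℕ → S}

open Classical in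
theorem sum_ite_of_eq_of (x y : S) (n : ℕ) :
    ((∑ h ∈ range n, if AdelicLevel.of S (h + 1) x = .of S (h + 1) y then 1 else 0 : ℕ) : ℕ∞) =
      min (n : ℕ∞) (addVal R ((x : R) - y)) := by
  rw [← sum_ite_mem_maximalIdeal_pow]
  simp only [AdelicLevel.of_eq_of_iff]

theorem subsetFactorial_eq_sum (hs : IsFactorialDetermining S fun n => (s n : R)) (n : ℕ) :
    subsetFactorial S n = ∑ j ∈ range n, addVal R ((s n : R) - s j) := by
  rw [subsetFactorial_eq hs, addVal_prod]

theorem subsetFactorial_le_sum (hs : IsFactorialDetermining S fun n => (s n : R)) (n : ℕ) (x : S) :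
    subsetFactorial S n ≤ ∑ j ∈ range n, addVal R ((x : R) - s j) := by
  rw [subsetFactorial_eq hs, ← addVal_prod]
  exact hs.minimal n x x.2

open Classical in
theorem sum_agreements_le_subsetFactorial (hS : S.Infinite)
    (hs : IsFactorialDetermining S fun n => (s n : R)) (n m : ℕ) :
    ∑ j ∈ range n, ∑ h ∈ range m,
      (if AdelicLevel.of S (h + 1) (s n) = .of S (h + 1) (s j) then 1 else 0 : ℝ) ≤
        (subsetFactorial S n).toNat := by
  have h1 : ((∑ j ∈ range n, ∑ h ∈ range m,
      (if AdelicLevel.of S (h + 1) (s n) = .of S (h + 1) (s j) then 1 else 0) : ℕ) : ℕ∞) ≤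
        (subsetFactorial S n).toNat := by
    rw [coe_toNat_subsetFactorial hS, subsetFactorial_eq_sum hs, Nat.cast_sum]
    refine sum_le_sum fun j _ => ?_
    rw [sum_ite_of_eq_of]
    exact min_le_right _ _
  have h2 := Nat.cast_le.1 h1
  have h3 : ((∑ j ∈ range n, ∑ h ∈ range m,
      (if AdelicLevel.of S (h + 1) (s n) = .of S (h + 1) (s j) then 1 else 0) : ℕ) : ℝ) ≤
        (subsetFactorial S n).toNat := Nat.cast_le.2 h2
  push_cast at h3
  exact h3

-- Counting agreements only up to level `m + 1` loses nothing when `x` is separated from every `s j`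
-- at that level.
open Classical in
theorem subsetFactorial_le_sum_agreements (hS : S.Infinite)
    (hs : IsFactorialDetermining S fun n => (s n : R)) (n m : ℕ) (x : S)
    (hx : ∀ j < n, AdelicLevel.of S (m + 1) x ≠ .of S (m + 1) (s j)) :
    ((subsetFactorial S n).toNat : ℝ) ≤ ∑ j ∈ range n, ∑ h ∈ range (m + 1),
      (if AdelicLevel.of S (h + 1) x = .of S (h + 1) (s j) then 1 else 0 : ℝ) := by
  have h1 : ((subsetFactorial S n).toNat : ℕ∞) ≤ ((∑ j ∈ range n, ∑ h ∈ range (m + 1),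
      (if AdelicLevel.of S (h + 1) x = .of S (h + 1) (s j) then 1 else 0) : ℕ) : ℕ∞) := by
    rw [coe_toNat_subsetFactorial hS, Nat.cast_sum]
    refine (subsetFactorial_le_sum hs n x).trans (sum_le_sum fun j hj => ?_)
    rw [sum_ite_of_eq_of]
    refine le_min ?_ le_rfl
    have h2 := hx j (mem_range.1 hj)
    rw [Ne, AdelicLevel.of_eq_of_iff, ← coe_le_addVal_iff, not_le] at h2
    exact h2.le
  have h2 := Nat.cast_le.1 h1
  have h3 : ((subsetFactorial S n).toNat : ℝ) ≤ ((∑ j ∈ range n, ∑ h ∈ range (m + 1),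
      (if AdelicLevel.of S (h + 1) x = .of S (h + 1) (s j) then 1 else 0) : ℕ) : ℝ) :=
    Nat.cast_le.2 h2
  push_cast at h3
  exact h3

/-! ### Comparison of the growth of the factorials with the energy -/

variable [Finite (IsLocalRing.ResidueField R)]
  {η ν : (h : ℕ) → AdelicLevel S (h + 1) → ℝ≥0}

-- The restricted flow has the same total at every level, and at level `0` it sits on a single
-- vertex.
open Classical in
theorem sum_ite_restrictFlow (hη : IsUnitFlow S η) (x : S) {h m : ℕ} (hm : h ≤ m)
    (rep : AdelicLevel S (m + 1) → S) (hrep : ∀ v, AdelicLevel.of S (m + 1) (rep v) = v) :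
    ∑ v, (if AdelicLevel.of S (h + 1) (rep v) = .of S (h + 1) x then η m v else 0) =
      η h (.of S (h + 1) x) := by
  have h1 : ∀ k, ∑ v, restrictFlow η x h k v = η h (.of S (h + 1) x) := by
    intro k
    induction k with
    | zero =>
      simp only [restrictFlow_of_le η x (Nat.zero_le h)]
      rw [sum_ite_eq', if_pos (mem_univ _)]
    | succ k ih =>
      rw [← ih, ← sum_fiberwise_parent]
      refine sum_congr rfl fun v _ => ?_
      rw [restrictFlow_conserved hη]
  rw [← h1 m]
  refine sum_congr rfl fun v _ => ?_
  conv_rhs => rw [← hrep v, restrictFlow_of_ge _ _ hm]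
  rw [hrep]

/-- The path sums are bounded, so their terms tend to zero. -/
theorem IsUnitCurrentFlow.tendsto_zero (hη : IsUnitCurrentFlow S η) (x : S) :
    Tendsto (fun h => (η h (.of S (h + 1) x) : ℝ)) atTop (𝓝 0) := by
  have h1 : Summable fun h => (η h (.of S (h + 1) x) : ℝ) := by
    refine summable_of_sum_range_le (c := ∑' h, ∑ v, (η h v : ℝ) ^ 2)
      (fun _ => NNReal.zero_le_coe) fun n => ?_
    have := hη.pathFlow_le x n
    rw [pathFlow] at this
    push_cast at this
    exact this
  exact h1.tendsto_atTop_zero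

/-- The logarithmic factorials grow at most linearly, with slope the energy of the unit current
flow. -/
theorem IsUnitCurrentFlow.subsetFactorial_le (hη : IsUnitCurrentFlow S η) (hS : S.Infinite)
    (n : ℕ) : ((subsetFactorial S n).toNat : ℝ) ≤ n * ∑' h, ∑ v, (η h v : ℝ) ^ 2 := by
  classical
  obtain ⟨s', hs'⟩ := exists_isFactorialDetermining hS.nonempty
  obtain ⟨s, hs⟩ : ∃ s : ℕ → S, IsFactorialDetermining S fun n => (s n : R) :=
    ⟨fun n => ⟨s' n, hs'.mem n⟩, hs'⟩
  set a : ℝ := ((subsetFactorial S n).toNat : ℝ)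
  have ha : 0 ≤ a := Nat.cast_nonneg _
  -- The test point runs over representatives of the classes in `V_{m+1}`, weighted by `η m`.
  -- Classes that contain some `s j` must be discarded, as the truncated count says nothing there;
  -- the correction on the left pays for them.
  have key : ∀ m, a * (1 - ∑ j ∈ range n, (η m (.of S (m + 1) (s j)) : ℝ)) ≤
      n * ∑' h, ∑ v, (η h v : ℝ) ^ 2 := by
    intro m
    choose rep hrep using AdelicLevel.of_surjective (S := S) (m + 1)
    calc a * (1 - ∑ j ∈ range n, (η m (.of S (m + 1) (s j)) : ℝ))
        = ∑ v, (η m v : ℝ) * (a * (1 - ∑ j ∈ range n, if v = .of S (m + 1) (s j) then 1 else 0)) := by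
          have h1 : ∑ v, (η m v : ℝ) = 1 := by exact_mod_cast hη.unitFlow.sum_eq_one m
          have h2 : ∑ v, ∑ j ∈ range n, (η m v : ℝ) * (if v = .of S (m + 1) (s j) then 1 else 0) =
              ∑ j ∈ range n, (η m (.of S (m + 1) (s j)) : ℝ) := by
            rw [sum_comm]
            refine sum_congr rfl fun j _ => ?_
            simp
          rw [← h2]
          simp only [mul_left_comm _ a, ← mul_sum, mul_sub, sum_sub_distrib, mul_one]
          rw [← sum_mul, h1, one_mul]
      _ ≤ ∑ v, (η m v : ℝ) * ∑ j ∈ range n, ∑ h ∈ range (m + 1),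
            (if AdelicLevel.of S (h + 1) (rep v) = .of S (h + 1) (s j) then 1 else 0 : ℝ) := by
          refine sum_le_sum fun v _ => mul_le_mul_of_nonneg_left ?_ NNReal.zero_le_coe
          have h0 : 0 ≤ ∑ j ∈ range n, ∑ h ∈ range (m + 1),
            (if AdelicLevel.of S (h + 1) (rep v) = .of S (h + 1) (s j) then 1 else 0 : ℝ) :=
            sum_nonneg fun j _ => sum_nonneg fun h _ => by split_ifs <;> simp
          -- For a discarded class the factor `1 - ∑` is at most zero, so the left side is harmless.
          by_cases hv : ∃ j < n, v = .of S (m + 1) (s j)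
          · obtain ⟨j, hj, hvj⟩ := hv
            refine le_trans (mul_nonpos_of_nonneg_of_nonpos ha ?_) h0
            rw [sub_nonpos]
            refine le_trans ?_ (single_le_sum (fun j _ => by split_ifs <;> simp) (mem_range.2 hj))
            rw [if_pos hvj]
          · push Not at hv
            rw [sum_eq_zero fun j hj => if_neg (hv j (mem_range.1 hj)), sub_zero, mul_one]
            refine subsetFactorial_le_sum_agreements hS hs n m (rep v) fun j hj => ?_
            rw [hrep]
            exact hv j hj
      _ = ∑ j ∈ range n, (pathFlow η (s j) (m + 1) : ℝ) := by
          simp only [mul_sum]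
          rw [sum_comm]
          refine sum_congr rfl fun j _ => ?_
          rw [sum_comm, pathFlow, NNReal.coe_sum]
          refine sum_congr rfl fun h hh => ?_
          rw [← sum_ite_restrictFlow hη.unitFlow (s j) (Nat.lt_succ_iff.1 (mem_range.1 hh)) rep hrep,
            NNReal.coe_sum]
          refine sum_congr rfl fun v _ => ?_
          split_ifs <;> simp
      _ ≤ ∑ j ∈ range n, ∑' h, ∑ v, (η h v : ℝ) ^ 2 :=
          sum_le_sum fun j _ => hη.pathFlow_le _ _
      _ = n * ∑' h, ∑ v, (η h v : ℝ) ^ 2 := by simp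
  -- With `n` fixed, the mass of the discarded classes vanishes as `m` grows.
  have hlim : Tendsto (fun m => a * (1 - ∑ j ∈ range n, (η m (.of S (m + 1) (s j)) : ℝ))) atTop
      (𝓝 (a * (1 - ∑ j ∈ range n, 0))) :=
    (tendsto_const_nhds.sub (tendsto_finsetSum _ fun j _ => hη.tendsto_zero (s j))).const_mul a
  rw [sum_const_zero, sub_zero, mul_one] at hlim
  exact le_of_tendsto' hlim key

/-- The sum of squares of the class counts counts ordered pairs of agreeing terms. Adding `s n`
creates twice its agreements with the earlier terms, at most `2 n L` in all, plus one diagonal pair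
per level. The `m` levels of diagonal pairs cause the error `m / n`. -/
theorem sum_sq_empiricalFlow_le (hS : S.Infinite)
    (hs : IsFactorialDetermining S fun n => (s n : R)) {L : ℝ}
    (hL : ∀ n : ℕ, ((subsetFactorial S n).toNat : ℝ) ≤ n * L) (m : ℕ) {n : ℕ} (hn : n ≠ 0) :
    ∑ h ∈ range m, ∑ v, (empiricalFlow s n h v : ℝ) ^ 2 ≤ L + m / n := by
  classical
  let N : ℕ → (h : ℕ) → AdelicLevel S (h + 1) → ℝ := fun n h v =>
    ∑ j ∈ range n, if AdelicLevel.of S (h + 1) (s j) = v then 1 else 0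
  have hL0 : 0 ≤ L := by
    have := hL 1
    rw [Nat.cast_one, one_mul] at this
    exact (Nat.cast_nonneg _).trans this
  have key : ∀ n, ∑ h ∈ range m, ∑ v, N n h v ^ 2 ≤ L * n ^ 2 + n * m := by
    intro n
    induction n with
    | zero => simp [N]
    | succ n ih =>
      have h1 : ∀ h, ∑ v, N (n + 1) h v ^ 2 =
          ∑ v, N n h v ^ 2 + 2 * N n h (.of S (h + 1) (s n)) + 1 := by
        intro h
        have h2 : ∀ v, N (n + 1) h v ^ 2 = N n h v ^ 2 +
            (if AdelicLevel.of S (h + 1) (s n) = v then 2 * N n h v + 1 else 0) := fun v => by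
          rw [show N (n + 1) h v = N n h v + if AdelicLevel.of S (h + 1) (s n) = v then 1 else 0
            from sum_range_succ _ _]
          split_ifs <;> ring
        simp only [h2]
        rw [sum_add_distrib, sum_ite_eq, if_pos (mem_univ _), add_assoc]
      have h3 : ∑ h ∈ range m, N n h (.of S (h + 1) (s n)) ≤ n * L := by
        refine le_trans (le_of_eq ?_) ((sum_agreements_le_subsetFactorial hS hs n m).trans (hL n))
        simp only [N]
        rw [sum_comm]
        simp only [eq_comm]
      simp only [h1]
      rw [sum_add_distrib, sum_add_distrib, ← mul_sum]
      simp only [sum_const, card_range, nsmul_eq_mul, mul_one]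
      push_cast
      nlinarith
  have hn0 : (0 : ℝ) < n := by positivity
  have h4 : ∑ h ∈ range m, ∑ v, (empiricalFlow s n h v : ℝ) ^ 2 =
      (∑ h ∈ range m, ∑ v, N n h v ^ 2) / n ^ 2 := by
    rw [sum_div]
    refine sum_congr rfl fun h _ => ?_
    rw [sum_div]
    refine sum_congr rfl fun v _ => ?_
    rw [← div_pow]
    congr 1
    simp only [empiricalFlow, N]
    push_cast
    congr 1
    exact sum_congr rfl fun j _ => by split_ifs <;> simp
  rw [h4, div_le_iff₀ (by positivity)]
  refine (key n).trans (le_of_eq ?_)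
  field_simp

/-- Limits of the empirical flows are unit flows of energy at most the growth rate of the
logarithmic factorials. -/
theorem flowEnergy_le_of_tendsto_empiricalFlow (hS : S.Infinite)
    (hs : IsFactorialDetermining S fun n => (s n : R)) {L : ℝ}
    (hL : ∀ n : ℕ, ((subsetFactorial S n).toNat : ℝ) ≤ n * L) {F : Filter ℕ} [F.NeBot]
    (hF : F ≤ atTop) (hν : Tendsto (empiricalFlow s) F (𝓝 ν)) :
    IsUnitFlow S ν ∧ flowEnergy ν ≤ ENNReal.ofReal L := by
  have hne : ∀ᶠ n in F, n ≠ 0 := hF (eventually_ne_atTop 0)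
  refine ⟨isClosed_setOf_isUnitFlow.mem_of_tendsto hν (hne.mono fun n hn =>
    isUnitFlow_empiricalFlow s hn), ENNReal.tsum_le_of_sum_range_le fun m => ?_⟩
  have h1 : Tendsto (fun n => ∑ h ∈ range m, ∑ v, (empiricalFlow s n h v : ℝ) ^ 2) F
      (𝓝 (∑ h ∈ range m, ∑ v, (ν h v : ℝ) ^ 2)) := by
    refine tendsto_finsetSum _ fun h _ => tendsto_finsetSum _ fun v _ => ?_
    exact (NNReal.tendsto_coe.2 ((tendsto_pi_nhds.1 ((tendsto_pi_nhds.1 hν) h)) v)).pow 2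
  -- The truncation level `m` is fixed while `n` grows, so the diagonal error disappears before `m`
  -- is released.
  have h2 : Tendsto (fun n : ℕ => L + m / n) F (𝓝 (L + 0)) :=
    ((tendsto_const_div_atTop_nhds_zero_nat (m : ℝ)).mono_left hF).const_add L
  rw [add_zero] at h2
  have h3 := le_of_tendsto_of_tendsto h1 h2
    (hne.mono fun n hn => sum_sq_empiricalFlow_le hS hs hL m hn)
  refine le_trans (le_of_eq ?_) (ENNReal.ofReal_le_ofReal h3)
  rw [ENNReal.ofReal_sum_of_nonneg fun h _ => by positivity]
  refine sum_congr rfl fun h _ => ?_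
  rw [ENNReal.ofReal_sum_of_nonneg fun v _ => by positivity]
  refine sum_congr rfl fun v _ => ?_
  rw [ENNReal.ofReal_pow NNReal.zero_le_coe, ENNReal.ofReal_coe_nnreal]

theorem exists_isUnitFlow_of_subsetFactorial_le (hS : S.Infinite)
    (hs : IsFactorialDetermining S fun n => (s n : R)) {L : ℝ}
    (hL : ∀ n : ℕ, ((subsetFactorial S n).toNat : ℝ) ≤ n * L) :
    ∃ ν, IsUnitFlow S ν ∧ flowEnergy ν ≤ ENNReal.ofReal L := by
  obtain ⟨ν, -, hν⟩ := (isCompact_setOf_isUnitFlow (S := S)).exists_mapClusterPt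
    (f := atTop) (u := empiricalFlow s)
    (le_principal_iff.2 (mem_map.2
      ((eventually_ne_atTop 0).mono fun n hn => isUnitFlow_empiricalFlow s hn)))
  obtain ⟨U, hU, hUν⟩ := mapClusterPt_iff_ultrafilter.1 hν
  exact ⟨ν, flowEnergy_le_of_tendsto_empiricalFlow hS hs hL hU hUν⟩

/-- The growth rate of the logarithmic factorials is the energy of the unit current flow. -/
theorem IsUnitCurrentFlow.tendsto_subsetFactorial_div (hη : IsUnitCurrentFlow S η)
    (hS : S.Infinite) :
    Tendsto (fun n : ℕ => ((subsetFactorial S n).toNat : ℝ) / n) atTop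
      (𝓝 (∑' h, ∑ v, (η h v : ℝ) ^ 2)) := by
  obtain ⟨s', hs'⟩ := exists_isFactorialDetermining hS.nonempty
  obtain ⟨s, hs⟩ : ∃ s : ℕ → S, IsFactorialDetermining S fun n => (s n : R) :=
    ⟨fun n => ⟨s' n, hs'.mem n⟩, hs'⟩
  obtain ⟨L, hlim, hL⟩ := exists_tendsto_subsetFactorial_div hS (hη.subsetFactorial_le hS)
  have h1 : L ≤ ∑' h, ∑ v, (η h v : ℝ) ^ 2 := by
    refine le_of_tendsto' hlim fun n => ?_
    refine div_le_of_le_mul₀ (Nat.cast_nonneg _) (tsum_nonneg fun h => by positivity) ?_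
    rw [mul_comm]
    exact hη.subsetFactorial_le hS n
  obtain ⟨ν, hν, hνL⟩ := exists_isUnitFlow_of_subsetFactorial_le hS hs hL
  -- Minimality of `η` against a limit of empirical flows gives the lower bound on the growth rate.
  have h2 := (hη.minimal ν hν).trans hνL
  rw [flowEnergy_eq_ofReal hη.bounded] at h2
  have hL0 : 0 ≤ L := ge_of_tendsto' hlim fun n => by positivity
  rw [ENNReal.ofReal_le_ofReal_iff hL0] at h2
  rwa [le_antisymm h1 h2] at hlim

theorem IsUnitCurrentFlow.energy_pos (hη : IsUnitCurrentFlow S η) :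
    0 < ∑' h, ∑ v, (η h v : ℝ) ^ 2 := by
  have hs := flowEnergy_lt_top_iff_summable.1 hη.bounded
  refine hs.tsum_pos (fun h => by positivity) 0 (lt_of_le_of_ne (by positivity) fun h0 => ?_)
  have h1 := (sum_eq_zero_iff_of_nonneg fun v _ => by positivity).1 h0.symm
  have h2 : ∑ v, η 0 v = 0 := sum_eq_zero fun v hv => by
    have := h1 v hv
    rwa [sq_eq_zero_iff, NNReal.coe_eq_zero] at this
  rw [hη.unitFlow.total] at h2
  exact one_ne_zero h2

/-- Along a factorial-determining sequence, the empirical flows converge to the unit current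
flow. -/
theorem IsUnitCurrentFlow.tendsto_empiricalFlow (hη : IsUnitCurrentFlow S η) (hS : S.Infinite)
    (hs : IsFactorialDetermining S fun n => (s n : R)) :
    Tendsto (empiricalFlow s) atTop (𝓝 η) := by
  refine (isCompact_setOf_isUnitFlow (S := S)).tendsto_nhds_of_unique_mapClusterPt
    ((eventually_ne_atTop 0).mono fun n hn => isUnitFlow_empiricalFlow s hn) fun ν _ hν => ?_
  obtain ⟨U, hU, hUν⟩ := mapClusterPt_iff_ultrafilter.1 hν
  obtain ⟨h1, h2⟩ := flowEnergy_le_of_tendsto_empiricalFlow hS hs (hη.subsetFactorial_le hS) hU hUν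
  rw [← flowEnergy_eq_ofReal hη.bounded] at h2
  exact hη.unique ⟨h1, h2.trans_lt hη.bounded, fun θ hθ => h2.trans (hη.minimal θ hθ)⟩

theorem isTransientSubset_iff_exists_tendsto (hS : S.Infinite) :
    IsTransientSubset S hS.nonempty ↔ ∃ H : ℝ, 0 < H ∧
      Tendsto (fun n : ℕ => ((subsetFactorial S n).toNat : ℝ) / n) atTop (𝓝 H) := by
  rw [isTransientSubset_iff_exists_isUnitFlow]
  constructor
  · rintro ⟨θ, hθ, he⟩
    obtain ⟨η, hη⟩ := exists_isUnitCurrentFlow hθ he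
    exact ⟨_, hη.energy_pos, hη.tendsto_subsetFactorial_div hS⟩
  · rintro ⟨H, -, hH⟩
    obtain ⟨s', hs'⟩ := exists_isFactorialDetermining hS.nonempty
    obtain ⟨ν, hν, he⟩ := exists_isUnitFlow_of_subsetFactorial_le
      (s := fun n => ⟨s' n, hs'.mem n⟩) hS hs' (subsetFactorial_le_of_tendsto hS hH)
    exact ⟨ν, hν, he.trans_lt ENNReal.ofReal_lt_top⟩

end FactorialFlow

/-! ### Measures on the closure -/

section ClosureMeasure

open IsLocalRing

set_option linter.unusedSectionVars false

variable {R : Type*} [CommRing R] [IsLocalRing R]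

theorem redMod_eq_redMod_iff {h : ℕ} {x y : R} :
    redMod R h x = redMod R h y ↔ x - y ∈ maximalIdeal R ^ h := Ideal.Quotient.eq

theorem redMod_eq_of_le {h k : ℕ} (hk : h ≤ k) {x y : R} (hxy : redMod R k x = redMod R k y) :
    redMod R h x = redMod R h y :=
  redMod_eq_redMod_iff.2 (Ideal.pow_le_pow_right hk (redMod_eq_redMod_iff.1 hxy))

variable [IsNoetherianRing R] [Finite (ResidueField R)]
  [TopologicalSpace R] [IsTopologicalRing R] [CompactSpace R] [T2Space R]

/-- The powers of the maximal ideal are compact and decrease to zero by Krull's intersection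
theorem, so one of them lies in any given neighbourhood of zero. -/
theorem exists_maximalIdeal_pow_subset {x : R} {U : Set R} (hU : U ∈ 𝓝 x) :
    ∃ h, ∀ y, y - x ∈ maximalIdeal R ^ h → y ∈ U := by
  have hU0 : (fun z => z + x) ⁻¹' U ∈ 𝓝 (0 : R) := by
    refine (continuous_add_const x).continuousAt.preimage_mem_nhds ?_
    rwa [zero_add]
  obtain ⟨h, hh⟩ := exists_subset_nhds_of_isCompact
    (V := fun h : ℕ => ((maximalIdeal R ^ h : Ideal R) : Set R))
    (U := (fun z => z + x) ⁻¹' U)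
    (directed_of_isDirected_le fun h k hk => Ideal.pow_le_pow_right hk)
    (fun h => (IsNoetherianRing.isClosed_ideal _).isCompact) fun z hz => by
      have h1 : z ∈ ⨅ h : ℕ, maximalIdeal R ^ h := by
        rw [Ideal.mem_iInf]
        exact Set.mem_iInter.1 hz
      rw [Ideal.iInf_pow_eq_bot_of_isLocalRing _ (maximalIdeal.isMaximal R).ne_top,
        Ideal.mem_bot] at h1
      rwa [h1]
  exact ⟨h, fun y hy => by simpa using hh hy⟩

variable {S : Set R}

theorem redMod_mem_image_of_mem_closure (h : ℕ) {x : R} (hx : x ∈ closure S) :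
    ∃ s : S, redMod R h x = redMod R h s := by
  have hopen : IsOpen {y : R | y - x ∈ maximalIdeal R ^ h} :=
    (isOpen_maximalIdeal_pow R h).preimage (continuous_sub_right x)
  obtain ⟨s, hs, hsS⟩ := mem_closure_iff.1 hx _ hopen (by simp)
  exact ⟨⟨s, hsS⟩, (redMod_eq_redMod_iff.2 hs).symm⟩

/-- The elements of the closure that reduce to `v`. -/
def closureBall (h : ℕ) (v : AdelicLevel S h) : Set (closure S) := {x | redMod R h x = v.1}

theorem mem_closureBall_of_iff {h : ℕ} {x : closure S} {s : S} :
    x ∈ closureBall h (.of S h s) ↔ redMod R h x = redMod R h s := Iff.rfl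

theorem exists_mem_closureBall (h : ℕ) (x : closure S) : ∃ s : S, x ∈ closureBall h (.of S h s) :=
  redMod_mem_image_of_mem_closure h x.2

theorem eq_of_mem_closureBall {h : ℕ} {x : closure S} {v w : AdelicLevel S h}
    (hv : x ∈ closureBall h v) (hw : x ∈ closureBall h w) : v = w :=
  Subtype.ext (hv.symm.trans hw)

theorem isClopen_closureBall (h : ℕ) (v : AdelicLevel S h) : IsClopen (closureBall h v) := by
  obtain ⟨s, rfl⟩ := AdelicLevel.of_surjective h v
  have h1 : closureBall h (.of S h s) = {x : closure S | (x : R) - s ∈ maximalIdeal R ^ h} := by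
    ext x
    exact redMod_eq_redMod_iff
  rw [h1]
  exact ⟨(IsNoetherianRing.isClosed_ideal (maximalIdeal R ^ h)).preimage (by fun_prop),
    (isOpen_maximalIdeal_pow R h).preimage (by fun_prop)⟩

theorem iUnion_closureBall (h : ℕ) : ⋃ v : AdelicLevel S h, closureBall h v = Set.univ := by
  refine Set.eq_univ_of_forall fun x => ?_
  obtain ⟨s, hs⟩ := exists_mem_closureBall h x
  exact Set.mem_iUnion.2 ⟨_, hs⟩

theorem pairwise_disjoint_closureBall (h : ℕ) :
    Pairwise (Function.onFun Disjoint (closureBall (S := S) h)) := by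
  intro v w hvw
  refine Set.disjoint_left.2 fun x hv hw => hvw (eq_of_mem_closureBall hv hw)

/-- The balls of positive level. -/
def closureBalls (S : Set R) : Set (Set (closure S)) :=
  {B | ∃ (h : ℕ) (v : AdelicLevel S (h + 1)), closureBall (h + 1) v = B}

theorem isTopologicalBasis_closureBalls : TopologicalSpace.IsTopologicalBasis (closureBalls S) := by
  refine TopologicalSpace.isTopologicalBasis_of_isOpen_of_nhds ?_ fun x U hx hU => ?_
  · rintro _ ⟨h, v, rfl⟩
    exact (isClopen_closureBall _ v).isOpen
  · obtain ⟨U', hU', rfl⟩ := isOpen_induced_iff.1 hU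
    obtain ⟨h, hh⟩ := exists_maximalIdeal_pow_subset (hU'.mem_nhds hx)
    obtain ⟨s, hs⟩ := exists_mem_closureBall (h + 1) x
    refine ⟨_, ⟨h, _, rfl⟩, hs, fun y hy => hh y ?_⟩
    rw [← redMod_eq_redMod_iff]
    exact redMod_eq_of_le h.le_succ (hy.trans hs.symm)

theorem countable_closureBalls : (closureBalls S).Countable := by
  have h1 : closureBalls S = ⋃ h : ℕ, Set.range (closureBall (S := S) (h + 1)) := by
    ext B
    simp [closureBalls]
  rw [h1]
  exact Set.countable_iUnion fun h => (Set.finite_range _).countable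

instance : SecondCountableTopology (closure S) :=
  isTopologicalBasis_closureBalls.secondCountableTopology countable_closureBalls

/-- Two balls are nested or disjoint. -/
theorem isPiSystem_closureBalls : IsPiSystem (closureBalls S) := by
  have key : ∀ (h k : ℕ) (_ : h ≤ k) (v : AdelicLevel S (h + 1)) (w : AdelicLevel S (k + 1)),
      (closureBall (h + 1) v ∩ closureBall (k + 1) w).Nonempty →
        closureBall (k + 1) w ⊆ closureBall (h + 1) v := by
    rintro h k hk v w ⟨x, hxv, hxw⟩ y hy
    have h1 : redMod R (h + 1) (y : R) = redMod R (h + 1) x :=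
      redMod_eq_of_le (by omega) ((show redMod R (k + 1) (y : R) = w.1 from hy).trans
        (show redMod R (k + 1) (x : R) = w.1 from hxw).symm)
    exact h1.trans hxv
  rintro _ ⟨h, v, rfl⟩ _ ⟨k, w, rfl⟩ hne
  obtain hk | hk := le_total h k
  · rw [Set.inter_eq_right.2 (key h k hk v w hne)]
    exact ⟨k, w, rfl⟩
  · rw [Set.inter_eq_left.2 (key k h hk w v (by rwa [Set.inter_comm]))]
    exact ⟨h, v, rfl⟩

variable [MeasurableSpace R] [BorelSpace R]

theorem measurableSet_closureBall (h : ℕ) (v : AdelicLevel S h) :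
    MeasurableSet (closureBall h v) := (isClopen_closureBall h v).isOpen.measurableSet

variable {η : (h : ℕ) → AdelicLevel S (h + 1) → ℝ≥0} {μ ν : Measure (closure S)}

theorem IsUnitFlow.isProbabilityMeasure (hη : IsUnitFlow S η)
    (hμ : ∀ (h : ℕ) (v : AdelicLevel S (h + 1)), μ (closureBall (h + 1) v) = η h v) :
    IsProbabilityMeasure μ := by
  refine ⟨?_⟩
  rw [← iUnion_closureBall 1, measure_iUnion (pairwise_disjoint_closureBall 1)
    (measurableSet_closureBall 1), tsum_fintype]
  simp only [hμ]
  rw [← ENNReal.ofNNReal_finsetSum, hη.total, ENNReal.coe_one]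

/-- A measure on the closure is determined by the masses of the balls. -/
theorem IsUnitFlow.measure_ext (hη : IsUnitFlow S η)
    (hμ : ∀ (h : ℕ) (v : AdelicLevel S (h + 1)), μ (closureBall (h + 1) v) = η h v)
    (hν : ∀ (h : ℕ) (v : AdelicLevel S (h + 1)), ν (closureBall (h + 1) v) = η h v) : μ = ν := by
  have := hη.isProbabilityMeasure hμ
  have := hη.isProbabilityMeasure hν
  refine ext_of_generate_finite (closureBalls S) ?_ isPiSystem_closureBalls ?_ (by simp)
  · rw [← isTopologicalBasis_closureBalls.borel_eq_generateFrom]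
    exact BorelSpace.measurable_eq
  · rintro _ ⟨h, v, rfl⟩
    rw [hμ, hν]

/-! ### Empirical measures -/

/-- The embedding of `S` into its closure. -/
def toClosure (s : S) : closure S := ⟨s, subset_closure s.2⟩

/-- The average of the Dirac masses at the first `n + 1` terms. -/
noncomputable def empiricalMeasure (s : ℕ → S) (n : ℕ) : ProbabilityMeasure (closure S) :=
  ⟨((n + 1 : ℕ) : ℝ≥0∞)⁻¹ • ∑ j ∈ Finset.range (n + 1), Measure.dirac (toClosure (s j)), by
    refine ⟨?_⟩
    simp only [Measure.smul_apply, Measure.coe_finsetSum, Finset.sum_apply, smul_eq_mul,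
      measure_univ, Finset.sum_const, Finset.card_range, nsmul_eq_mul, mul_one]
    exact ENNReal.inv_mul_cancel (by simp) (ENNReal.natCast_ne_top _)⟩

theorem integral_empiricalMeasure (s : ℕ → S) (n : ℕ) (f : closure S →ᵇ ℝ) :
    ∫ x, f x ∂(empiricalMeasure s n : Measure (closure S)) =
      (∑ j ∈ Finset.range (n + 1), f (toClosure (s j))) / (n + 1 : ℕ) := by
  change ∫ x, f x ∂(((n + 1 : ℕ) : ℝ≥0∞)⁻¹ •
    ∑ j ∈ Finset.range (n + 1), Measure.dirac (toClosure (s j))) = _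
  rw [integral_smul_measure, integral_finsetSum_measure fun j _ => f.integrable _]
  simp only [integral_dirac]
  rw [ENNReal.toReal_inv, ENNReal.toReal_natCast, smul_eq_mul, div_eq_inv_mul]

theorem integral_indicator_closureBall_empiricalMeasure (s : ℕ → S) (n : ℕ) {h : ℕ}
    (v : AdelicLevel S (h + 1)) :
    ∫ x, BoundedContinuousFunction.indicator _ (isClopen_closureBall (h + 1) v) x
      ∂(empiricalMeasure s n : Measure (closure S)) = empiricalFlow s (n + 1) h v := by
  classical
  rw [integral_empiricalMeasure, empiricalFlow]
  push_cast
  congr 1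
  refine Finset.sum_congr rfl fun j _ => ?_
  have h1 : toClosure (s j) ∈ closureBall (h + 1) v ↔ AdelicLevel.of S (h + 1) (s j) = v :=
    ⟨fun h1 => Subtype.ext h1, fun h1 => congrArg Subtype.val h1⟩
  by_cases h2 : AdelicLevel.of S (h + 1) (s j) = v
  · simp [h2, h1.2 h2]
  · simp [h2, mt h1.1 h2]

/-- Balls are clopen, so their indicators are continuous test functions, and the empirical measures
integrate them to the empirical flows. -/
theorem measure_closureBall_of_tendsto {s : ℕ → S} {F : Filter ℕ} [F.NeBot] (hF : F ≤ atTop)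
    (hη : Tendsto (empiricalFlow s) atTop (𝓝 η)) {P : ProbabilityMeasure (closure S)}
    (hP : Tendsto (empiricalMeasure s) F (𝓝 P)) (h : ℕ) (v : AdelicLevel S (h + 1)) :
    (P : Measure (closure S)) (closureBall (h + 1) v) = η h v := by
  have h1 := ProbabilityMeasure.tendsto_iff_forall_integral_tendsto.1 hP
    (BoundedContinuousFunction.indicator _ (isClopen_closureBall (h + 1) v))
  simp only [integral_indicator_closureBall_empiricalMeasure] at h1
  have h2 : Tendsto (fun n => (empiricalFlow s (n + 1) h v : ℝ)) F (𝓝 (η h v)) :=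
    ((NNReal.tendsto_coe.2 (tendsto_pi_nhds.1 (tendsto_pi_nhds.1 hη h) v)).comp
      (tendsto_add_atTop_nat 1)).mono_left hF
  have h3 := tendsto_nhds_unique h1 h2
  have h4 : ∫ x, BoundedContinuousFunction.indicator _ (isClopen_closureBall (h + 1) v) x
      ∂(P : Measure (closure S)) = (P : Measure (closure S)).real (closureBall (h + 1) v) := by
    simp only [BoundedContinuousFunction.indicator_apply]
    exact integral_indicator_one (measurableSet_closureBall _ v)
  rw [h4] at h3
  rw [← ENNReal.ofReal_coe_nnreal, ← h3, ofReal_measureReal]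

/-- If the empirical flows converge to a unit flow, then the empirical measures converge to a
measure that realizes it. -/
theorem IsUnitFlow.exists_tendsto_empiricalMeasure (hη : IsUnitFlow S η) {s : ℕ → S}
    (hs : Tendsto (empiricalFlow s) atTop (𝓝 η)) :
    ∃ P : ProbabilityMeasure (closure S), Tendsto (empiricalMeasure s) atTop (𝓝 P) ∧
      ∀ (h : ℕ) (v : AdelicLevel S (h + 1)),
        (P : Measure (closure S)) (closureBall (h + 1) v) = η h v := by
  have : CompactSpace (closure S) := isCompact_iff_compactSpace.1 isClosed_closure.isCompact
  have key : ∀ P, MapClusterPt P atTop (empiricalMeasure s) → ∀ (h : ℕ) (v : AdelicLevel S (h + 1)),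
        (P : Measure (closure S)) (closureBall (h + 1) v) = η h v := by
    intro P hP
    obtain ⟨U, hU, hUP⟩ := mapClusterPt_iff_ultrafilter.1 hP
    exact measure_closureBall_of_tendsto hU hs hUP
  obtain ⟨P, hP⟩ := exists_clusterPt_of_compactSpace (Filter.map (empiricalMeasure s) atTop)
  -- All cluster points give the balls the same masses and so coincide; compactness of the space of
  -- probability measures then yields convergence.
  refine ⟨P, tendsto_nhds_of_unique_mapClusterPt fun Q hQ => ?_, key P hP⟩
  exact Subtype.ext (hη.measure_ext (key Q hQ) (key P hP))

theorem isEquidistributed_of_tendsto_empiricalMeasure {s : ℕ → S}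
    {P : ProbabilityMeasure (closure S)} (hP : Tendsto (empiricalMeasure s) atTop (𝓝 P)) :
    IsEquidistributed (P : Measure (closure S)) fun n => toClosure (s n) := by
  intro f
  have h1 := ProbabilityMeasure.tendsto_iff_forall_integral_tendsto.1 hP f
  simp only [integral_empiricalMeasure] at h1
  exact (tendsto_add_atTop_iff_nat
    (f := fun n : ℕ => (∑ j ∈ Finset.range n, f (toClosure (s j))) / n) 1).1 h1

end ClosureMeasure

/-! ### The energy integral of the harmonic measure -/

section EnergyIntegral

open IsDiscreteValuationRing IsLocalRing

set_option linter.unusedSectionVars false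

variable {R : Type*} [CommRing R] [IsDomain R] [IsDiscreteValuationRing R]
  [Finite (ResidueField R)] [TopologicalSpace R] [IsTopologicalRing R] [CompactSpace R] [T2Space R]
  {S : Set R} {η : (h : ℕ) → AdelicLevel S (h + 1) → ℝ≥0}

theorem sum_indicator_closureBall_mul (h : ℕ) (x : closure S) (F : AdelicLevel S h → ℝ≥0∞)
    {s : S} (hs : x ∈ closureBall h (.of S h s)) :
    ∑ v, (closureBall h v).indicator 1 x * F v = F (.of S h s) := by
  rw [Finset.sum_eq_single (AdelicLevel.of S h s)]
  · simp [hs]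
  · intro v _ hv
    rw [Set.indicator_of_notMem fun hx => hv (eq_of_mem_closureBall hx hs), zero_mul]
  · exact fun h => absurd (Finset.mem_univ _) h

/-- Separating the variables ball by ball reduces the measurability of the valuation and its
integrals to masses of balls. -/
theorem addVal_sub_eq_tsum (x y : closure S) :
    (addVal R ((x : R) - y) : ℝ≥0∞) = ∑' h, ∑ v : AdelicLevel S (h + 1),
      (closureBall (h + 1) v).indicator 1 x * (closureBall (h + 1) v).indicator 1 y := by
  classical
  rw [← tsum_ite_mem_maximalIdeal_pow]
  refine tsum_congr fun h => ?_
  obtain ⟨s, hs⟩ := exists_mem_closureBall (h + 1) x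
  rw [sum_indicator_closureBall_mul (h + 1) x _ hs]
  rw [Set.indicator_apply]
  refine if_congr ?_ rfl rfl
  rw [← redMod_eq_redMod_iff, mem_closureBall_of_iff, ← mem_closureBall_of_iff.1 hs, eq_comm]

variable [MeasurableSpace R] [BorelSpace R] {μ : Measure (closure S)}

theorem measurable_indicator_closureBall (h : ℕ) (v : AdelicLevel S h) :
    Measurable ((closureBall h v).indicator (1 : closure S → ℝ≥0∞)) :=
  measurable_one.indicator (measurableSet_closureBall h v)

theorem measurable_addVal_sub :
    Measurable fun p : closure S × closure S => (addVal R ((p.1 : R) - p.2) : ℝ≥0∞) := by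
  simp only [addVal_sub_eq_tsum]
  refine Measurable.tsum fun h => Finset.measurable_fun_sum _ fun v _ => ?_
  exact ((measurable_indicator_closureBall _ v).comp measurable_fst).mul
    ((measurable_indicator_closureBall _ v).comp measurable_snd)

theorem lintegral_addVal_sub
    (hμ : ∀ (h : ℕ) (v : AdelicLevel S (h + 1)), μ (closureBall (h + 1) v) = η h v)
    (x : closure S) : ∫⁻ y, (addVal R ((x : R) - (y : R)) : ℝ≥0∞) ∂μ =
      ∑' h, ∑ v : AdelicLevel S (h + 1), (closureBall (h + 1) v).indicator 1 x * (η h v : ℝ≥0∞) := by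
  simp only [addVal_sub_eq_tsum]
  rw [lintegral_tsum fun h => (Finset.measurable_fun_sum _ fun v _ =>
    (measurable_indicator_closureBall _ v).const_mul _).aemeasurable]
  refine tsum_congr fun h => ?_
  rw [lintegral_finsetSum _ fun v _ => (measurable_indicator_closureBall _ v).const_mul _]
  refine Finset.sum_congr rfl fun v _ => ?_
  rw [lintegral_const_mul _ (measurable_indicator_closureBall _ v),
    lintegral_indicator_one (measurableSet_closureBall _ v), hμ]

theorem lintegral_lintegral_addVal_sub
    (hμ : ∀ (h : ℕ) (v : AdelicLevel S (h + 1)), μ (closureBall (h + 1) v) = η h v) :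
    ∫⁻ x, ∫⁻ y, (addVal R ((x : R) - (y : R)) : ℝ≥0∞) ∂μ ∂μ = flowEnergy η := by
  simp only [lintegral_addVal_sub hμ]
  rw [lintegral_tsum fun h => (Finset.measurable_fun_sum _ fun v _ =>
    (measurable_indicator_closureBall _ v).mul_const _).aemeasurable]
  refine tsum_congr fun h => ?_
  rw [lintegral_finsetSum _ fun v _ => (measurable_indicator_closureBall _ v).mul_const _]
  refine Finset.sum_congr rfl fun v _ => ?_
  rw [lintegral_mul_const _ (measurable_indicator_closureBall _ v),
    lintegral_indicator_one (measurableSet_closureBall _ v), hμ, pow_two]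

/-- The first `n` terms of the series for the potential at `x` form the path sum of any `s ∈ S`
congruent to `x` at level `n`. Hence the bound on the voltage holds at every point of the closure.
-/
theorem IsUnitCurrentFlow.lintegral_addVal_sub_le (hη : IsUnitCurrentFlow S η)
    (hμ : ∀ (h : ℕ) (v : AdelicLevel S (h + 1)), μ (closureBall (h + 1) v) = η h v)
    (x : closure S) :
    ∫⁻ y, (addVal R ((x : R) - (y : R)) : ℝ≥0∞) ∂μ ≤ flowEnergy η := by
  rw [lintegral_addVal_sub hμ]
  refine ENNReal.tsum_le_of_sum_range_le fun n => ?_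
  obtain ⟨s, hs⟩ := exists_mem_closureBall n x
  have h1 : ∀ h ∈ Finset.range n, ∑ v : AdelicLevel S (h + 1),
      (closureBall (h + 1) v).indicator 1 x * (η h v : ℝ≥0∞) = η h (.of S (h + 1) s) :=
    fun h hh => sum_indicator_closureBall_mul (h + 1) x (fun v => (η h v : ℝ≥0∞))
      (redMod_eq_of_le (Finset.mem_range.1 hh) hs)
  rw [Finset.sum_congr rfl h1, flowEnergy_eq_ofReal hη.bounded, ← ENNReal.ofNNReal_finsetSum,
    ← ENNReal.ofReal_coe_nnreal]
  exact ENNReal.ofReal_le_ofReal (hη.pathFlow_le s n)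

/-- A function bounded above by its finite mean, for a probability measure, equals it almost
everywhere. -/
theorem IsUnitCurrentFlow.ae_lintegral_addVal_sub_eq (hη : IsUnitCurrentFlow S η)
    (hμ : ∀ (h : ℕ) (v : AdelicLevel S (h + 1)), μ (closureBall (h + 1) v) = η h v) :
    ∀ᵐ x ∂μ, flowEnergy η = ∫⁻ y, (addVal R ((x : closure S) - (y : R) : R) : ℝ≥0∞) ∂μ := by
  have := hη.unitFlow.isProbabilityMeasure hμ
  have h1 := ae_eq_of_ae_le_of_lintegral_le (μ := μ)
    (f := fun x : closure S => ∫⁻ y : closure S, (addVal R ((x : R) - (y : R)) : ℝ≥0∞) ∂μ)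
    (g := fun _ => flowEnergy η) (ae_of_all _ (hη.lintegral_addVal_sub_le hμ))
    (by rw [lintegral_lintegral_addVal_sub hμ]; exact hη.bounded.ne) aemeasurable_const
    (by rw [lintegral_lintegral_addVal_sub hμ]; simp)
  exact h1.mono fun x hx => hx.symm

theorem IsUnitCurrentFlow.setLIntegral_addVal_sub_eq (hη : IsUnitCurrentFlow S η)
    (hμ : ∀ (h : ℕ) (v : AdelicLevel S (h + 1)), μ (closureBall (h + 1) v) = η h v) :
    ∫⁻ p in {p : closure S × closure S | p.1 ≠ p.2}, (addVal R ((p.1 : R) - p.2) : ℝ≥0∞)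
      ∂(μ.prod μ) = flowEnergy η := by
  have := hη.unitFlow.isProbabilityMeasure hμ
  have h1 : ∫⁻ p : closure S × closure S, (addVal R ((p.1 : R) - p.2) : ℝ≥0∞) ∂(μ.prod μ) =
      flowEnergy η := by
    rw [lintegral_prod _ measurable_addVal_sub.aemeasurable, lintegral_lintegral_addVal_sub hμ]
  -- The integral is finite and the integrand is infinite on the diagonal, so the diagonal is null.
  have h2 : ∀ᵐ p ∂(μ.prod μ), p ∈ {p : closure S × closure S | p.1 ≠ p.2} := by
    refine (ae_lt_top measurable_addVal_sub (by rw [h1]; exact hη.bounded.ne)).mono ?_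
    rintro ⟨x, y⟩ hp hxy
    obtain rfl : x = y := hxy
    simp at hp
  rw [Measure.restrict_eq_self_of_ae_mem h2, h1]

/-- A transient subset has a unique harmonic measure, which governs the distribution of its
factorial-determining sequences and the growth of its factorials. -/
theorem exists_isHarmonicMeasure_of_isTransientSubset (hS : S.Infinite)
    (ht : IsTransientSubset S hS.nonempty) :
      ∃ μ : Measure (closure S),
        IsHarmonicMeasure S μ ∧ (∀ ν, IsHarmonicMeasure S ν → ν = μ) ∧
        (∀ (s : ℕ → R) (hs : IsFactorialDetermining S s),
          IsEquidistributed μ (fun n => (⟨s n, subset_closure (hs.mem n)⟩ : closure S))) ∧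
        ∃ H : ℝ,
          Tendsto (fun n : ℕ => ((subsetFactorial S n).toNat : ℝ) / n) atTop (𝓝 H) ∧
          ENNReal.ofReal H =
            ∫⁻ p in {p : closure S × closure S | p.1 ≠ p.2},
              (IsDiscreteValuationRing.addVal R ((p.1 : R) - p.2) : ℝ≥0∞) ∂(μ.prod μ) ∧
          ∀ᵐ (x₀ : closure S) ∂μ, ENNReal.ofReal H =
            ∫⁻ y, (IsDiscreteValuationRing.addVal R ((x₀ : R) - (y : R)) : ℝ≥0∞) ∂μ := by
  obtain ⟨θ, hθ, he⟩ := (isTransientSubset_iff_exists_isUnitFlow hS.nonempty).1 ht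
  obtain ⟨η, hη⟩ := exists_isUnitCurrentFlow hθ he
  have hconv : ∀ (s : ℕ → R) (hs : IsFactorialDetermining S s),
      ∃ P : ProbabilityMeasure (closure S),
        Tendsto (empiricalMeasure fun n => (⟨s n, hs.mem n⟩ : S)) atTop (𝓝 P) ∧
          ∀ (h : ℕ) (v : AdelicLevel S (h + 1)),
            (P : Measure (closure S)) (closureBall (h + 1) v) = η h v := fun s hs =>
    hη.unitFlow.exists_tendsto_empiricalMeasure (hη.tendsto_empiricalFlow hS hs)
  obtain ⟨s₀, hs₀⟩ := exists_isFactorialDetermining hS.nonempty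
  obtain ⟨P, -, hP⟩ := hconv s₀ hs₀
  refine ⟨P, ⟨η, hη, hP⟩, ?_, fun s hs => ?_, _, hη.tendsto_subsetFactorial_div hS, ?_⟩
  · rintro ν ⟨η', hη', hν⟩
    rw [hη.unique hη'] at hν
    exact hη.unitFlow.measure_ext (ν := (P : Measure (closure S))) hν hP
  · obtain ⟨Q, hQ, hQη⟩ := hconv s hs
    obtain rfl : Q = P := Subtype.ext (hη.unitFlow.measure_ext hQη hP)
    have h1 := isEquidistributed_of_tendsto_empiricalMeasure hQ
    simp only [toClosure] at h1
    exact h1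
  · rw [← flowEnergy_eq_ofReal hη.bounded]
    exact ⟨(hη.setLIntegral_addVal_sub_eq hP).symm, hη.ae_lintegral_addVal_sub_eq hP⟩

end EnergyIntegral

/-! ### Specialization to the valuation ring of a local field -/

theorem t2Space_integer (K : Type*) [Field K] [ValuativeRel K] [TopologicalSpace K]
    [IsNonarchimedeanLocalField K] : T2Space 𝒪[K] := by
  let := IsTopologicalAddGroup.rightUniformSpace K
  have := isUniformAddGroup_of_addCommGroup (G := K)
  have : T2Space K := inferInstance
  infer_instance

theorem mainTheorem3 {K : Type*} [Field K] [ValuativeRel K] [TopologicalSpace K]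
    [IsNonarchimedeanLocalField K] [MeasurableSpace K] [BorelSpace K]
    (S : Set 𝒪[K]) (hS : S.Infinite) :
    (IsTransientSubset S hS.nonempty ↔
      ∃ H : ℝ, 0 < H ∧
        Tendsto (fun n : ℕ => ((subsetFactorial S n).toNat : ℝ) / n) atTop (𝓝 H)) ∧
    (IsTransientSubset S hS.nonempty →
      ∃ μ : Measure (closure S),
        IsHarmonicMeasure S μ ∧ (∀ ν, IsHarmonicMeasure S ν → ν = μ) ∧
        (∀ (s : ℕ → 𝒪[K]) (hs : IsFactorialDetermining S s),
          IsEquidistributed μ (fun n => (⟨s n, subset_closure (hs.mem n)⟩ : closure S))) ∧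
        ∃ H : ℝ,
          Tendsto (fun n : ℕ => ((subsetFactorial S n).toNat : ℝ) / n) atTop (𝓝 H) ∧
          ENNReal.ofReal H =
            ∫⁻ p in {p : closure S × closure S | p.1 ≠ p.2},
              (IsDiscreteValuationRing.addVal 𝒪[K] ((p.1 : 𝒪[K]) - p.2) : ℝ≥0∞) ∂(μ.prod μ) ∧
          ∀ᵐ (x₀ : closure S) ∂μ, ENNReal.ofReal H =
            ∫⁻ y, (IsDiscreteValuationRing.addVal 𝒪[K] ((x₀ : 𝒪[K]) - (y : 𝒪[K])) : ℝ≥0∞) ∂μ) := by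
  have := t2Space_integer K
  exact ⟨isTransientSubset_iff_exists_tendsto hS,
    exists_isHarmonicMeasure_of_isTransientSubset hS⟩
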